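/- Consider the following problem. An instance consists of a finite simple unweighted graph $G=(V,E)$ (every edge has cost $1$), a finite set $\Pi$ of packets, and $g$ commodities; commodity $j$ has a terminal set $X_j\subseteq V$ and a demand set $D_j\subseteq\Pi$. A solution is a collection $\mathcal T=(T_1,\dots,T_g)$ of subtrees of $G$ such that $T_j$ contains all vertices of $X_j$. Its cost is $\ell(\mathcal T)=\sum_{e\in E}\bigl|\bigcup_{j:\,e\in T_j}D_j\bigr|$, the sum over all edges of the number of distinct packets routed over the edge. Assume * (sunflower demands) there is a set $P\subseteq\Pi$ with $D_i\cap D_j=P$ for all $i\neq j$; * every vertex of $G$ belongs to some terminal set with at least two elements (so $V=\bigcup_j X_j$; if all terminal sets have at least two elements, the condition is just $V=\bigcup_j X_j$); * the instance is feasible, that is, it has at least one solution. Then the problem has a polynomial-time $O(\log g)$-approximation: there are a constant $C$, a polynomial $p$ and a deterministic algorithm (a program for a random access machine with unit-cost addition, subtraction and array access, given the adjacency matrix of $G$ and the incidence matrices of the terminal sets and of the demand sets) which on every such instance halts after at most $p(|V|+g)$ steps and outputs a solution $\mathcal T$ such that $$\ell(\mathcal T)\le C\cdot\max(1,\log_2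 g)\cdot\ell(\mathcal T')\qquad\text{for every solution }\mathcal T'.$$ -/

import Mathlib

/-! ## A random access machine with step counts -/

namespace RAM

/-- The memory of the machine: registers, and named two-dimensional arrays, all holding
natural numbers. -/
structure Store where
  reg : ℕ → ℕ
  arr : ℕ → ℕ → ℕ → ℕ

/-- Expressions: constants, registers, array cells, addition and truncated subtraction.
There is no multiplication, so in `t` steps the bit length of the numbers in the memory grows
by at most `O(t)`, and polynomial time with unit costs is the usual polynomial time. -/
inductive Expr where
  | lit (k : ℕ)
  | reg (r : ℕ)
  | cell (a : ℕ) (i j : Expr)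
  | add (x y : Expr)
  | sub (x y : Expr)

/-- The value of an expression. -/
def Expr.val (s : Store) : Expr → ℕ
  | .lit k => k
  | .reg r => s.reg r
  | .cell a i j => s.arr a (i.val s) (j.val s)
  | .add x y => x.val s + y.val s
  | .sub x y => x.val s - y.val s

/-- The number of operations needed to evaluate an expression. -/
def Expr.cost : Expr → ℕ
  | .lit _ => 1
  | .reg _ => 1
  | .cell _ i j => i.cost + j.cost + 1
  | .add x y => x.cost + y.cost + 1
  | .sub x y => x.cost + y.cost + 1

/-- Programs. The names of registers and arrays are fixed in the program, the
indices of array cells are computed at run time. Tests are of the form `x ≠ 0`. -/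
inductive Prog where
  | skip
  | assign (r : ℕ) (x : Expr)
  | write (a : ℕ) (i j x : Expr)
  | seq (p q : Prog)
  | cond (x : Expr) (p q : Prog)
  | loop (x : Expr) (p : Prog)

/-- The store after register `r` receives the value `k`. -/
def Store.setReg (s : Store) (r k : ℕ) : Store :=
  { s with reg := fun r' => if r' = r then k else s.reg r' }

/-- The store after cell `(i, j)` of array `a` receives the value `k`. -/
def Store.setCell (s : Store) (a i j k : ℕ) : Store :=
  { s with arr := fun a' i' j' => if a' = a ∧ i' = i ∧ j' = j then k else s.arr a' i' j' }

/-- `Exec p s t s'`: started in the store `s`, the program `p` halts after exactly `t` steps, and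
the store is then `s'`. -/
inductive Exec : Prog → Store → ℕ → Store → Prop
  | skip (s : Store) : Exec .skip s 1 s
  | assign (s : Store) (r : ℕ) (x : Expr) :
      Exec (.assign r x) s (x.cost + 1) (s.setReg r (x.val s))
  | write (s : Store) (a : ℕ) (i j x : Expr) :
      Exec (.write a i j x) s (i.cost + j.cost + x.cost + 1)
        (s.setCell a (i.val s) (j.val s) (x.val s))
  | seq {p q : Prog} {s s₁ s₂ : Store} {t₁ t₂ : ℕ} :
      Exec p s t₁ s₁ → Exec q s₁ t₂ s₂ → Exec (.seq p q) s (t₁ + t₂) s₂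
  | condTrue {x : Expr} {p q : Prog} {s s' : Store} {t : ℕ} :
      x.val s ≠ 0 → Exec p s t s' → Exec (.cond x p q) s (x.cost + 1 + t) s'
  | condFalse {x : Expr} {p q : Prog} {s s' : Store} {t : ℕ} :
      x.val s = 0 → Exec q s t s' → Exec (.cond x p q) s (x.cost + 1 + t) s'
  | loopDone {x : Expr} {p : Prog} {s : Store} :
      x.val s = 0 → Exec (.loop x p) s (x.cost + 1) s
  | loopStep {x : Expr} {p : Prog} {s s₁ s₂ : Store} {t₁ t₂ : ℕ} :
      x.val s ≠ 0 → Exec p s t₁ s₁ → Exec (.loop x p) s₁ t₂ s₂ →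
        Exec (.loop x p) s (x.cost + 1 + t₁ + t₂) s₂

end RAM

/-! ## Network design with coverage costs on unweighted graphs -/

namespace CoverageDesign

/-- The demand sets form a sunflower: any two of them meet in the same set `P` of packets. -/
def IsSunflower {g m : ℕ} (D : Fin g → Finset (Fin m)) : Prop :=
  ∃ P : Finset (Fin m), ∀ i j : Fin g, i ≠ j → D i ∩ D j = P

/-- A routing solution: for every commodity `j`, a subgraph of `G` that is a tree and
contains all terminals in `X j`. -/
def IsSolution {n g : ℕ} {G : SimpleGraph (Fin n)} (X : Fin g → Finset (Fin n))
    (T : Fin g → G.Subgraph) : Prop :=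
  ∀ j : Fin g, (T j).coe.IsTree ∧ ∀ v ∈ X j, v ∈ (T j).verts

open Classical in
/-- The number of distinct packets that are routed over the edge `e`. -/
noncomputable def load {n g m : ℕ} {G : SimpleGraph (Fin n)} (D : Fin g → Finset (Fin m))
    (T : Fin g → G.Subgraph) (e : Sym2 (Fin n)) : ℕ :=
  ((Finset.univ.filter fun j : Fin g => e ∈ (T j).edgeSet).biUnion D).card

open Classical in
/-- The cost of a routing solution: the sum of the loads of all edges, every edge of the unweighted
graph having cost one per packet. -/
noncomputable def routingCost {n g m : ℕ} {G : SimpleGraph (Fin n)} (D : Fin g → Finset (Fin m))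
    (T : Fin g → G.Subgraph) : ℕ :=
  ∑ e ∈ G.edgeFinset, load D T e

open Classical in
/-- The initial store for an instance: registers `0`, `1`, `2` hold the numbers of vertices, of
commodities and of packets; arrays `0`, `1`, `2` hold the adjacency matrix and the
zero-one matrices of the terminal sets and of the demand sets; everything else is zero. -/
noncomputable def input {n g m : ℕ} (G : SimpleGraph (Fin n)) (X : Fin g → Finset (Fin n))
    (D : Fin g → Finset (Fin m)) : RAM.Store where
  reg r := match r with
    | 0 => n
    | 1 => g
    | 2 => m
    | _ => 0
  arr a i k := match a with
    | 0 => if ∃ u v : Fin n, u.val = i ∧ v.val = k ∧ G.Adj u v then 1 else 0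
    | 1 => if ∃ (j : Fin g) (v : Fin n), j.val = i ∧ v.val = k ∧ v ∈ X j then 1 else 0
    | 2 => if ∃ (j : Fin g) (q : Fin m), j.val = i ∧ q.val = k ∧ q ∈ D j then 1 else 0
    | _ => 0

/-- The store `s` holds the trees `T` as output, in parent-pointer form: in array `3`, the cell
`(j, v)` holds `w + 1` if the tree of commodity `j` has an edge from `v` to its parent `w`, and
for example `0` if `v` has no parent in that tree. -/
def IsOutput {n g : ℕ} {G : SimpleGraph (Fin n)} (s : RAM.Store)
    (T : Fin g → G.Subgraph) : Prop :=
  ∀ (j : Fin g) (v w : Fin n),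
    (T j).Adj v w ↔ s.arr 3 j v = (w : ℕ) + 1 ∨ s.arr 3 j w = (v : ℕ) + 1

end CoverageDesign

/-!
The algorithm connects the terminals of one commodity after the other by the greedy Steiner tree
heuristic: the tree starts with one terminal, and is extended again and again by a shortest path to
the nearest terminal outside it. Edges are *bought* when they are used for the first time. With
`R` the least number such that `g ≤ 2 ^ R`, an edge that has already been bought has length `1`,
and every other edge has length `2 * R + 2`, in the search for shortest paths.

*Each tree is cheap.* A tree `T'` that contains the terminals gives a closed walk of length
`2 |E(T')|` through all of them, hence links between terminals of this total length which
connect them (`budget_of_isTree`). Whenever the heuristic reaches a new terminal, one link that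
leaves the current tree becomes redundant (`Budget.step`), and its length, times `2 * R + 2`, is
at least the length of the path that has been added. So the heuristic uses at most
`2 * (2 * R + 2) * |E(T')|` edges.

*All trees together have at most `3 * n` edges.* When an edge `uv` is bought as the tree grows
from `u` to `v`, the vertex `v` is at distance at least `2 * R + 2` from the tree in the graph `F`
of bought edges (`far_of_tight`). If fewer than `g` vertices are at distance at most `R` from `v`
in `F`, the edge is *light*. The light edges form a graph of large girth, and by the
Moore bound there are at most `2 * n` of them (`Sparse.card_edgeSet_le`). If the edge is not
light, then the ball of radius `R` around `v` has at least `g` vertices, and it is disjoint from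
all former balls of this kind for the same commodity, so that there are at most `n / g` such edges
for each commodity (`Growth.grow`), and at most `n` in total.

*Comparison.* With the kernel `P` of the sunflower, the cost of a solution is
`|P|` times the number of edges used by some tree, plus the sum of `|D j \ P| * |E(T j)|`
(`routingCost_eq`). As all vertices lie in terminal sets with at least two elements, every solution
uses at least `n / 2` edges. So both parts are within a factor `O(R)` of the optimum.

The algorithm is written in a language with counting loops only, all of which run up to the number
of vertices or of commodities. Such a program has an evident meaning as a function on memories, and
runs in polynomial time (`RAM.Cmd.exists_exec`). For this reason, shortest paths are
computed by the Bellman–Ford algorithm with a fixed number of rounds.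
-/

/-! ### Counting-loop programs -/

namespace RAM

@[simp]
theorem Store.setReg_reg (s : Store) (r k r' : ℕ) :
    (s.setReg r k).reg r' = if r' = r then k else s.reg r' := rfl

@[simp]
theorem Store.setReg_arr (s : Store) (r k : ℕ) : (s.setReg r k).arr = s.arr := rfl

@[simp]
theorem Store.setCell_reg (s : Store) (a i j k : ℕ) : (s.setCell a i j k).reg = s.reg := rfl

@[simp]
theorem Store.setCell_arr (s : Store) (a i j k a' i' j' : ℕ) :
    (s.setCell a i j k).arr a' i' j' =
      if a' = a ∧ i' = i ∧ j' = j then k else s.arr a' i' j' := rfl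

/-- Programs all of whose loops are counting loops. `Cmd.loop r b p` runs `p` with the counter
`r` going through `0, 1, …` up to, but not including, the value of the register `b`. -/
inductive Cmd where
  | assign (r : ℕ) (x : Expr)
  | write (a : ℕ) (i j x : Expr)
  | seq (p q : Cmd)
  | when (x : Expr) (p : Cmd)
  | loop (r b : ℕ) (p : Cmd)

namespace Cmd

/-- The program for the machine that a command stands for. -/
def toProg : Cmd → Prog
  | assign r x => .assign r x
  | write a i j x => .write a i j x
  | seq p q => .seq p.toProg q.toProg
  | when x p => .cond x p.toProg .skip
  | loop r b p => .seq (.assign r (.lit 0))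
      (.loop (.sub (.reg b) (.reg r)) (.seq p.toProg (.assign r (.add (.reg r) (.lit 1)))))

/-- The store after a command has been run. -/
def den : Cmd → Store → Store
  | assign r x, s => s.setReg r (x.val s)
  | write a i j x, s => s.setCell a (i.val s) (j.val s) (x.val s)
  | seq p q, s => q.den (p.den s)
  | when x p, s => if x.val s = 0 then s else p.den s
  | loop r b p, s =>
      (fun s' => (p.den s').setReg r ((p.den s').reg r + 1))^[s.reg b] (s.setReg r 0)

/-- The registers that a command may change. -/
def regs : Cmd → List ℕ
  | assign r _ => [r]
  | write _ _ _ _ => []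
  | seq p q => p.regs ++ q.regs
  | when _ p => p.regs
  | loop r _ p => r :: p.regs

/-- The arrays that a command may change. -/
def arrs : Cmd → List ℕ
  | assign _ _ => []
  | write a _ _ _ => [a]
  | seq p q => p.arrs ++ q.arrs
  | when _ p => p.arrs
  | loop _ _ p => p.arrs

/-- The loops of the command are bounded by the registers `0` and `1`, which are never changed,
and no loop changes its counter in its body. -/
def ok : Cmd → Bool
  | assign r _ => decide (2 ≤ r)
  | write _ _ _ _ => true
  | seq p q => p.ok && q.ok
  | when _ p => p.ok
  | loop r b p => p.ok && decide (2 ≤ r) && decide (b < 2) && decide (r ∉ p.regs)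

/-- A polynomial bound for the running time, in an upper bound for the registers `0` and `1`. -/
noncomputable def time : Cmd → Polynomial ℕ
  | assign _ x => Polynomial.C (x.cost + 1)
  | write _ i j x => Polynomial.C (i.cost + j.cost + x.cost + 1)
  | seq p q => p.time + q.time
  | when x p => Polynomial.C (x.cost + 2) + p.time
  | loop _ _ p => Polynomial.C 6 + Polynomial.X * (Polynomial.C 8 + p.time)

/-- The stores `s` and `s'` agree outside the registers and arrays that `p` may change. -/
def Frame (p : Cmd) (s s' : Store) : Prop :=
  (∀ r ∉ p.regs, s'.reg r = s.reg r) ∧ ∀ a ∉ p.arrs, s'.arr a = s.arr a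

theorem frame_den (p : Cmd) : ∀ s, Frame p s (p.den s) := by
  induction p with
  | assign r x =>
    intro s
    exact ⟨fun r' hr => by simp_all [den, regs, Store.setReg], fun _ _ => rfl⟩
  | write a i j x =>
    intro s
    refine ⟨fun _ _ => rfl, fun a' ha => ?_⟩
    funext i' j'
    simp_all [den, arrs, Store.setCell]
  | seq p q hp hq =>
    intro s
    refine ⟨fun r hr => ?_, fun a ha => ?_⟩
    · simp only [regs, List.mem_append, not_or] at hr
      exact ((hq _).1 r hr.2).trans ((hp s).1 r hr.1)
    · simp only [arrs, List.mem_append, not_or] at ha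
      exact ((hq _).2 a ha.2).trans ((hp s).2 a ha.1)
  | when x p hp =>
    intro s
    unfold den
    split
    · exact ⟨fun _ _ => rfl, fun _ _ => rfl⟩
    · exact hp s
  | loop r b p hp =>
    intro s
    unfold den
    generalize s.reg b = k
    induction k with
    | zero =>
      exact ⟨fun r' hr => by simp_all [regs, Store.setReg], fun _ _ => rfl⟩
    | succ k ih =>
      rw [Function.iterate_succ_apply']
      refine ⟨fun r' hr => ?_, fun a ha => ?_⟩
      · have hr' := hr
        simp only [regs, List.mem_cons, not_or] at hr
        simp only [Store.setReg, if_neg hr.1]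
        exact ((hp _).1 r' hr.2).trans (ih.1 r' hr')
      · exact ((hp _).2 a ha).trans (ih.2 a ha)

theorem two_le_of_mem_regs {p : Cmd} (h : p.ok = true) {r : ℕ} (hr : r ∈ p.regs) : 2 ≤ r := by
  induction p with
  | assign r' x => simp_all [ok, regs]
  | write a i j x => simp [regs] at hr
  | seq p q hp hq => simp [ok, regs] at h hr; tauto
  | when x p hp => exact hp h hr
  | loop r' b p hp =>
    simp only [ok, regs, Bool.and_eq_true, decide_eq_true_eq, List.mem_cons] at h hr
    rcases hr with rfl | hr
    · exact h.1.1.2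
    · exact hp h.1.1.1 hr

theorem den_reg {p : Cmd} (h : p.ok = true) (s : Store) {b : ℕ} (hb : b < 2) :
    (p.den s).reg b = s.reg b :=
  (frame_den p s).1 b fun hm => by have := two_le_of_mem_regs h hm; omega

/-- The machine runs a command in polynomial time, with the result that `Cmd.den` predicts. -/
theorem exists_exec {p : Cmd} (h : p.ok = true) {N : ℕ} :
    ∀ s : Store, s.reg 0 ≤ N → s.reg 1 ≤ N →
      ∃ t ≤ p.time.eval N, Exec p.toProg s t (p.den s) := by
  induction p with
  | assign r x => exact fun s _ _ => ⟨_, by simp [time], .assign s r x⟩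
  | write a i j x => exact fun s _ _ => ⟨_, by simp [time], .write s a i j x⟩
  | seq p q hp hq =>
    intro s h0 h1
    simp only [ok, Bool.and_eq_true] at h
    obtain ⟨t₁, ht₁, e₁⟩ := hp h.1 s h0 h1
    obtain ⟨t₂, ht₂, e₂⟩ := hq h.2 (p.den s) (by rwa [den_reg h.1 s (by norm_num)])
      (by rwa [den_reg h.1 s (by norm_num)])
    exact ⟨_, by simp only [time, Polynomial.eval_add]; omega, .seq e₁ e₂⟩
  | when x p hp =>
    intro s h0 h1
    by_cases hx : x.val s = 0
    · refine ⟨x.cost + 1 + 1, ?_, ?_⟩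
      · simp only [time, Polynomial.eval_add, Polynomial.eval_C]; omega
      · simp only [den, if_pos hx]
        exact .condFalse hx (.skip s)
    · obtain ⟨t, ht, e⟩ := hp h s h0 h1
      refine ⟨x.cost + 1 + t, ?_, ?_⟩
      · simp only [time, Polynomial.eval_add, Polynomial.eval_C]; omega
      · simp only [den, if_neg hx]
        exact .condTrue hx e
  | loop r b p hp =>
    intro s h0 h1
    simp only [ok, Bool.and_eq_true, decide_eq_true_eq] at h
    obtain ⟨⟨⟨hok, hr⟩, hb⟩, hrp⟩ := h
    have hrb : b ≠ r := by omega
    have key : ∀ k, ∀ s : Store, s.reg 0 ≤ N → s.reg 1 ≤ N → s.reg b - s.reg r = k →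
        ∃ t ≤ 4 + k * (8 + p.time.eval N),
          Exec (.loop (.sub (.reg b) (.reg r))
            (.seq p.toProg (.assign r (.add (.reg r) (.lit 1))))) s t
            ((fun s' => (p.den s').setReg r ((p.den s').reg r + 1))^[k] s) := by
      intro k
      induction k with
      | zero =>
        intro s _ _ hk
        exact ⟨_, by simp [Expr.cost], .loopDone hk⟩
      | succ k ih =>
        intro s h0 h1 hk
        obtain ⟨t₁, ht₁, e₁⟩ := hp hok s h0 h1
        have hreg : ∀ c < 2, ((p.den s).setReg r ((p.den s).reg r + 1)).reg c = s.reg c := by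
          intro c hc
          have : c ≠ r := by omega
          simp [Store.setReg, this, den_reg hok s hc]
        obtain ⟨t₂, ht₂, e₂⟩ := ih ((p.den s).setReg r ((p.den s).reg r + 1))
          (by rw [hreg 0 (by norm_num)]; exact h0) (by rw [hreg 1 (by norm_num)]; exact h1) (by
            rw [hreg b hb]
            simp only [Store.setReg, if_true, (frame_den p s).1 r hrp]
            omega)
        refine ⟨_, ?_, .loopStep (t₁ := t₁ + 4) (t₂ := t₂) ?_ (.seq e₁ (.assign _ r _)) e₂⟩
        · simp only [Expr.cost]
          rw [add_mul]
          omega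
        · simp only [Expr.val]; omega
    have hb0 : (s.setReg r 0).reg b = s.reg b := by simp [Store.setReg, hrb]
    obtain ⟨t, ht, e⟩ := key (s.reg b) (s.setReg r 0)
      (by simpa [Store.setReg, show 0 ≠ r by omega] using h0)
      (by simpa [Store.setReg, show 1 ≠ r by omega] using h1)
      (by rw [hb0]; simp [Store.setReg])
    refine ⟨_, ?_, .seq (.assign s r (.lit 0)) e⟩
    have hbN : s.reg b ≤ N := by interval_cases b <;> assumption
    have := Nat.mul_le_mul_right (8 + p.time.eval N) hbN
    simp only [time, Expr.cost, Polynomial.eval_add, Polynomial.eval_mul, Polynomial.eval_C,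
      Polynomial.eval_X]
    omega

/-- The invariant rule for counting loops. Inside the loop, the frame comes for free. -/
theorem loop_induction {r b : ℕ} {p : Cmd} {s : Store} (I : ℕ → Store → Prop)
    (hok : (loop r b p).ok = true)
    (h0 : I 0 (s.setReg r 0))
    (hs : ∀ k s', k < s.reg b → s'.reg r = k → Frame (loop r b p) s s' → I k s' →
      I (k + 1) ((p.den s').setReg r (k + 1))) :
    I (s.reg b) ((loop r b p).den s) := by
  simp only [ok, Bool.and_eq_true, decide_eq_true_eq] at hok
  have key : ∀ k ≤ s.reg b,
      let s' := (fun s' => (p.den s').setReg r ((p.den s').reg r + 1))^[k] (s.setReg r 0)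
      s'.reg r = k ∧ Frame (loop r b p) s s' ∧ I k s' := by
    intro k
    induction k with
    | zero =>
      intro _
      refine ⟨by simp [Store.setReg], ⟨fun r' hr => ?_, fun _ _ => rfl⟩, h0⟩
      simp_all [regs, Store.setReg]
    | succ k ih =>
      intro hk
      obtain ⟨h1, h2, h3⟩ := ih (by omega)
      simp only [Function.iterate_succ_apply']
      have h4 := (frame_den p ((fun s' => (p.den s').setReg r ((p.den s').reg r + 1))^[k]
        (s.setReg r 0))).1 r hok.2
      have h5 := hs k _ (by omega) h1 h2 h3
      rw [h1] at h4
      rw [h4]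
      refine ⟨by simp [Store.setReg], ⟨fun r' hr => ?_, fun a ha => ?_⟩, h5⟩
      · have hr' := hr
        simp only [regs, List.mem_cons, not_or] at hr
        simp only [Store.setReg, if_neg hr.1]
        exact ((frame_den p _).1 r' hr.2).trans (h2.1 r' hr')
      · exact ((frame_den p _).2 a ha).trans (h2.2 a ha)
  exact (key _ le_rfl).2.2

end Cmd

end RAM

/-! ### Sparse graphs of large girth -/

namespace CoverageDesign

open SimpleGraph

section HighGirth

variable {V : Type*}

/-- The vertices at distance at most `R` from `v` in `F`. -/
def ball (F : SimpleGraph V) (R : ℕ) (v : V) : Set V :=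
  {w | ∃ p : F.Walk v w, p.length ≤ R}

theorem ball_mono {F F' : SimpleGraph V} (h : F ≤ F') (R : ℕ) (v : V) :
    ball F R v ⊆ ball F' R v := by
  rintro w ⟨p, hp⟩
  exact ⟨p.mapLe h, by simpa using hp⟩

/-- The graphs that arise from the empty graph by adding edges `uv` one by one, where at that time
`u` and `v` are at distance at least `2 * R + 2`, and the ball of radius `R` around `v` has
fewer than `g` elements. -/
inductive Sparse (R g : ℕ) : SimpleGraph V → Prop
  | bot : Sparse R g ⊥
  | add {F : SimpleGraph V} {u v : V} : Sparse R g F → u ≠ v →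
      (∀ p : F.Walk u v, 2 * R + 2 ≤ p.length) → (ball F R v).ncard < g →
      Sparse R g (F ⊔ edge u v)

/-- Every edge lies on no cycle of length less than `2 * R + 3`. -/
def LargeGirth (R : ℕ) (F : SimpleGraph V) : Prop :=
  ∀ a b, F.Adj a b → ∀ p : (F.deleteEdges {s(a, b)}).Walk a b, 2 * R + 2 ≤ p.length

theorem LargeGirth.mono {R : ℕ} {F H : SimpleGraph V} (hF : LargeGirth R F) (h : H ≤ F) :
    LargeGirth R H := by
  intro a b hab p
  have := hF a b (h hab) (p.mapLe (deleteEdges_mono h))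
  simpa using this

/-- A walk that uses a new edge can be shortened such that it uses the edge at most once. -/
theorem exists_walk_of_sup_edge {K : SimpleGraph V} {u v x y : V} (p : (K ⊔ edge u v).Walk x y) :
    (∃ q : K.Walk x y, q.length ≤ p.length) ∨
    (∃ (q : K.Walk x u) (q' : K.Walk v y), q.length + q'.length + 1 ≤ p.length) ∨
    (∃ (q : K.Walk x v) (q' : K.Walk u y), q.length + q'.length + 1 ≤ p.length) := by
  induction p with
  | nil => exact .inl ⟨.nil, le_rfl⟩
  | @cons x x' y h p ih =>
    rw [sup_adj, edge_adj] at h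
    rcases h with h | ⟨⟨rfl, rfl⟩ | ⟨rfl, rfl⟩, -⟩
    · rcases ih with ⟨q, hq⟩ | ⟨q, q', hq⟩ | ⟨q, q', hq⟩
      · exact .inl ⟨.cons h q, by simpa using hq⟩
      · exact .inr (.inl ⟨.cons h q, q', by simp only [Walk.length_cons]; omega⟩)
      · exact .inr (.inr ⟨.cons h q, q', by simp only [Walk.length_cons]; omega⟩)
    · rcases ih with ⟨q, hq⟩ | ⟨q, q', hq⟩ | ⟨q, q', hq⟩
      · exact .inr (.inl ⟨.nil, q, by simpa using hq⟩)
      · exact .inr (.inl ⟨.nil, q', by simp only [Walk.length_cons, Walk.length_nil]; omega⟩)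
      · exact .inl ⟨q', by simp only [Walk.length_cons]; omega⟩
    · rcases ih with ⟨q, hq⟩ | ⟨q, q', hq⟩ | ⟨q, q', hq⟩
      · exact .inr (.inr ⟨.nil, q, by simpa using hq⟩)
      · exact .inl ⟨q', by simp only [Walk.length_cons]; omega⟩
      · exact .inr (.inr ⟨.nil, q', by simp only [Walk.length_cons, Walk.length_nil]; omega⟩)

/-- A new edge between vertices at distance at least `2 * R + 2` closes only long cycles. -/
theorem LargeGirth.sup_edge {R : ℕ} {F : SimpleGraph V} {u v : V} (hF : LargeGirth R F)
    (huv : ∀ p : F.Walk u v, 2 * R + 2 ≤ p.length) : LargeGirth R (F ⊔ edge u v) := by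
  have hvu : ∀ p : F.Walk v u, 2 * R + 2 ≤ p.length := fun p => by simpa using huv p.reverse
  intro a b hab p
  rw [sup_adj, edge_adj] at hab
  have hle : (F ⊔ edge u v).deleteEdges {s(a, b)} ≤ F.deleteEdges {s(a, b)} ⊔ edge u v := by
    intro x y hxy
    simp only [deleteEdges_adj, sup_adj] at hxy ⊢
    tauto
  rcases hab with hab | ⟨hab, -⟩
  · have hFle : F.deleteEdges {s(a, b)} ≤ F := deleteEdges_le _
    have hlen : (p.mapLe hle).length = p.length := by simp
    rcases exists_walk_of_sup_edge (p.mapLe hle) with ⟨q, hq⟩ | ⟨q, q', hq⟩ | ⟨q, q', hq⟩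
    · exact (hF a b hab q).trans (hq.trans hlen.le)
    · -- the new edge would close a short cycle through `ab`
      have := huv ((q.mapLe hFle).reverse.append (.cons hab (q'.mapLe hFle).reverse))
      simp at this
      omega
    · have := hvu ((q.mapLe hFle).reverse.append (.cons hab (q'.mapLe hFle).reverse))
      simp at this
      omega
  · have hle' : (F ⊔ edge u v).deleteEdges {s(a, b)} ≤ F := by
      intro x y hxy
      simp only [deleteEdges_adj, sup_adj, edge_adj, Set.mem_singleton_iff, Sym2.eq_iff] at hxy
      rcases hxy with ⟨h | ⟨h, -⟩, h'⟩
      · exact h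
      · exfalso
        rcases hab with ⟨rfl, rfl⟩ | ⟨rfl, rfl⟩ <;> tauto
    rcases hab with ⟨rfl, rfl⟩ | ⟨rfl, rfl⟩
    · simpa using huv (p.mapLe hle')
    · simpa using hvu (p.mapLe hle')

theorem Sparse.largeGirth {R g : ℕ} {F : SimpleGraph V} (h : Sparse R g F) : LargeGirth R F := by
  induction h with
  | bot => intro a b hab; exact absurd hab (by simp)
  | add _ _ huv _ ih => exact ih.sup_edge huv

/-- Within radius `R`, a graph of large girth looks like a tree: a vertex `w` at distance `r` from
`v` has at most one neighbour at distance at most `r`. -/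
theorem LargeGirth.eq_of_dist_le {R : ℕ} {F : SimpleGraph V} (hF : LargeGirth R F) {v w y₁ y₂ : V}
    {r : ℕ} (hr : r ≤ R) (hw : F.dist v w = r) (h₁ : F.Adj w y₁) (h₂ : F.Adj w y₂)
    (hy₁ : ∃ p : F.Walk v y₁, p.length ≤ r) (hy₂ : ∃ p : F.Walk v y₂, p.length ≤ r) :
    y₁ = y₂ := by
  classical
  by_contra hne
  obtain ⟨q₁, hq₁⟩ := hy₁
  obtain ⟨q₂, hq₂⟩ := hy₂
  -- a walk of length at most `r` cannot pass through `w`, except at its end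
  have avoid : ∀ {y : V} (q : F.Walk v y), q.length ≤ r → F.Adj w y → w ∉ q.support := by
    intro y q hq hwy hmem
    have h1 := dist_le (q.takeUntil w hmem)
    have h2 : (q.takeUntil w hmem).length + (q.dropUntil w hmem).length = q.length := by
      rw [← Walk.length_append, Walk.take_spec]
    exact hwy.ne (Walk.eq_of_length_eq_zero (p := q.dropUntil w hmem) (by omega))
  have e : ∀ {x y : V} (q : F.Walk x y), w ∉ q.support →
      ∃ q' : (F.deleteEdges {s(w, y₁)}).Walk x y, q'.length = q.length := by
    intro x y q hq
    refine ⟨q.toDeleteEdges _ ?_, by simp⟩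
    rintro e he rfl
    exact hq (q.fst_mem_support_of_mem_edges he)
  obtain ⟨q₁', h₁'⟩ := e q₁ (avoid q₁ hq₁ h₁)
  obtain ⟨q₂', h₂'⟩ := e q₂ (avoid q₂ hq₂ h₂)
  have hadj : (F.deleteEdges {s(w, y₁)}).Adj w y₂ := by
    rw [deleteEdges_adj]
    refine ⟨h₂, ?_⟩
    simp only [Set.mem_singleton_iff, Sym2.eq_iff, true_and]
    rintro (rfl | ⟨rfl, rfl⟩)
    · exact hne rfl
    · exact h₁.ne rfl
  have := hF w y₁ h₁ (.cons hadj (q₂'.reverse.append q₁'))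
  simp at this
  omega

/-- The vertices at distance exactly `r` from `v`. -/
def sphere (F : SimpleGraph V) (v : V) (r : ℕ) : Set V :=
  {w | F.Reachable v w ∧ F.dist v w = r}

/-- The Moore bound: where the girth is large and all degrees are at least three,
except at the centre, spheres double in each step. -/
theorem two_pow_le_card_sphere [Fintype V] {R : ℕ} {F : SimpleGraph V} (hF : LargeGirth R F)
    {v : V} (hv : 2 ≤ (F.neighborSet v).ncard)
    (hdeg : ∀ w ≠ v, F.Reachable v w → F.dist v w ≤ R → 3 ≤ (F.neighborSet w).ncard) :
    ∀ r ≤ R, 2 ^ r ≤ (sphere F v r).ncard := by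
  classical
  intro r
  induction r with
  | zero =>
    intro _
    rw [pow_zero]
    refine Nat.succ_le_iff.mpr ((Set.ncard_pos (Set.toFinite _)).mpr ?_)
    exact ⟨v, Reachable.refl v, SimpleGraph.dist_self⟩
  | succ r ih =>
    intro hr
    refine le_trans ?_ (b := (sphere F v r).ncard * 2) ?_
    · rw [pow_succ]; exact Nat.mul_le_mul_right 2 (ih (by omega))
    rw [Set.ncard_eq_toFinset_card' (sphere F v r),
      Set.ncard_eq_toFinset_card' (sphere F v (r + 1)),
      ← mul_one (Finset.card (Set.toFinset (sphere F v (r + 1))))]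
    refine Finset.card_mul_le_card_mul F.Adj ?_ ?_
    · intro w hw
      rw [Set.mem_toFinset] at hw
      have hsub : ∀ y, F.Adj w y → ¬ (∃ p : F.Walk v y, p.length ≤ r) → y ∈ sphere F v (r + 1) := by
        intro y hy hno
        have hre : F.Reachable v y := hw.1.trans hy.reachable
        obtain ⟨p, hp⟩ := hw.1.exists_walk_length_eq_dist
        obtain ⟨p', hp'⟩ := hre.exists_walk_length_eq_dist
        refine ⟨hre, le_antisymm ?_ ?_⟩
        · have := dist_le (p.concat hy)
          rw [Walk.length_concat, hp, hw.2] at this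
          exact this
        · by_contra hlt
          exact hno ⟨p', by omega⟩
      have hset : ∀ A : Set V, A ⊆ F.neighborSet w →
          (∀ y ∈ F.neighborSet w, y ∉ A → ¬ (∃ p : F.Walk v y, p.length ≤ r)) → A.ncard ≤ 1 →
          (r = 0 → A = ∅) →
          2 ≤ (Finset.bipartiteAbove F.Adj (sphere F v (r + 1)).toFinset w).card := by
        intro A hA hno hcard h0
        have h1 : F.neighborSet w \ A ⊆
            ↑(Finset.bipartiteAbove F.Adj (sphere F v (r + 1)).toFinset w) := by
          intro y hy
          rw [Finset.mem_coe, Finset.mem_bipartiteAbove, Set.mem_toFinset]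
          exact ⟨hsub y hy.1 (hno y hy.1 hy.2), hy.1⟩
        have h2 := Set.ncard_le_ncard h1 (Finset.finite_toSet _)
        rw [Set.ncard_coe_finset] at h2
        refine le_trans ?_ h2
        by_cases hwv : w = v
        · have : r = 0 := by rw [← hw.2, hwv, SimpleGraph.dist_self]
          rw [h0 this, Set.sdiff_empty, hwv]
          exact hv
        · have h3 := hdeg w hwv hw.1 (by rw [hw.2]; omega)
          have h4 := Set.le_ncard_sdiff A (F.neighborSet w) (Set.toFinite _)
          omega
      refine hset {y | F.Adj w y ∧ ∃ p : F.Walk v y, p.length ≤ r} (fun y hy => hy.1)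
        (fun y hy hyA h => hyA ⟨hy, h⟩) ?_ ?_
      · rw [Set.ncard_le_one]
        rintro a ⟨ha, ha'⟩ b ⟨hb, hb'⟩
        exact hF.eq_of_dist_le (by omega) hw.2 ha hb ha' hb'
      · rintro rfl
        refine Set.eq_empty_of_forall_notMem ?_
        rintro y ⟨hy, p, hp⟩
        have h1 : v = y := p.eq_of_length_eq_zero (by omega)
        obtain ⟨q, hq⟩ := hw.1.exists_walk_length_eq_dist
        have h2 : v = w := q.eq_of_length_eq_zero (by rw [hq, hw.2])
        exact hy.ne (h2.symm.trans h1)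
    · intro c hc
      rw [Set.mem_toFinset] at hc
      rw [Finset.card_le_one]
      intro a ha b hb
      rw [Finset.mem_bipartiteBelow, Set.mem_toFinset] at ha hb
      have far : ∀ x ∈ sphere F v r, ∃ p : F.Walk v x, p.length ≤ r + 1 := by
        rintro x ⟨hx, hx'⟩
        obtain ⟨p, hp⟩ := hx.exists_walk_length_eq_dist
        exact ⟨p, by omega⟩
      exact hF.eq_of_dist_le hr hc.2 ha.2.symm hb.2.symm (far a ha.1) (far b hb.1)

/-- The edges of `F` with both ends in `W`. -/
def edgesIn (F : SimpleGraph V) (W : Set V) : Set (Sym2 V) :=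
  {e ∈ F.edgeSet | ∀ x ∈ e, x ∈ W}

/-- A sparse graph has at most `2 |W|` edges inside any set `W`. Otherwise a minimal set `W`
with more than `2 |W|` edges has minimum degree at least three, and when its last edge `uv` was
added, the ball around `v` contained a sphere of radius `R`, hence `2 ^ R ≥ g` vertices. -/
theorem Sparse.card_edgesIn_le [Fintype V] {R g : ℕ} (hg : g ≤ 2 ^ R) {F : SimpleGraph V}
    (h : Sparse R g F) : ∀ W : Set V, (edgesIn F W).ncard ≤ 2 * W.ncard := by
  classical
  induction h with
  | bot => intro W; simp [edgesIn]
  | @add F u v hF hne huv hball ih =>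
    intro W
    induction hk : W.ncard using Nat.strong_induction_on generalizing W with
    | _ k ihW =>
    subst hk
    -- only the new edge can make a difference
    have hnew : ∀ A : Set V, edgesIn (F ⊔ edge u v) A ⊆ insert s(u, v) (edgesIn F A) := by
      rintro A e ⟨he, heA⟩
      induction e using Sym2.ind with
      | _ a b =>
      rw [mem_edgeSet, sup_adj, edge_adj] at he
      rcases he with he | ⟨⟨rfl, rfl⟩ | ⟨rfl, rfl⟩, -⟩
      · exact .inr ⟨he, heA⟩
      · exact .inl rfl
      · exact .inl Sym2.eq_swap
    by_cases huvW : u ∈ W ∧ v ∈ W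
    swap
    · have : edgesIn (F ⊔ edge u v) W ⊆ edgesIn F W := by
        intro e he
        rcases hnew W he with rfl | h
        · exact absurd ⟨he.2 u (by simp), he.2 v (by simp)⟩ huvW
        · exact h
      exact (Set.ncard_le_ncard this (Set.toFinite _)).trans (ih W)
    by_cases hdeg : ∀ x ∈ W, 3 ≤ {y ∈ W | (F ⊔ edge u v).Adj x y}.ncard
    · exfalso
      let H : SimpleGraph V :=
        { Adj := fun a b => F.Adj a b ∧ a ∈ W ∧ b ∈ W
          symm := ⟨fun a b h => ⟨h.1.symm, h.2.2, h.2.1⟩⟩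
          loopless := ⟨fun a h => h.1.ne rfl⟩ }
      have hHF : H ≤ F := fun a b h => h.1
      have hHW : ∀ {x y} (_ : H.Walk x y), x ∈ W → y ∈ W := by
        intro x y p
        induction p with
        | nil => exact id
        | cons h p ihp => exact fun _ => ihp h.2.2
      have hdegv : 2 ≤ (H.neighborSet v).ncard := by
        have h1 : {y ∈ W | (F ⊔ edge u v).Adj v y} ⊆ insert u (H.neighborSet v) := by
          rintro y ⟨hy, hvy⟩
          rw [sup_adj, edge_adj] at hvy
          rcases hvy with hvy | ⟨⟨h, -⟩ | ⟨-, rfl⟩, -⟩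
          · exact .inr ⟨hvy, huvW.2, hy⟩
          · exact absurd h.symm hne
          · exact .inl rfl
        have h2 := Set.ncard_le_ncard h1 (Set.toFinite _)
        have h3 := Set.ncard_insert_le u (H.neighborSet v)
        have h4 := hdeg v huvW.2
        omega
      have hsph := two_pow_le_card_sphere (hF.largeGirth.mono hHF) hdegv (R := R) (by
        intro w hwv hre hdist
        obtain ⟨p, hp⟩ := hre.exists_walk_length_eq_dist
        have hwW := hHW p huvW.2
        have hwu : w ≠ u := by
          rintro rfl
          have := huv (p.mapLe hHF).reverse
          simp at this
          omega
        refine (hdeg w hwW).trans (Set.ncard_le_ncard ?_ (Set.toFinite _))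
        rintro y ⟨hy, hwy⟩
        rw [sup_adj, edge_adj] at hwy
        rcases hwy with hwy | ⟨⟨h, -⟩ | ⟨h, -⟩, -⟩
        · exact ⟨hwy, hwW, hy⟩
        · exact absurd h hwu
        · exact absurd h hwv) R le_rfl
      have hsub : sphere H v R ⊆ ball F R v := by
        rintro w ⟨hre, hd⟩
        obtain ⟨p, hp⟩ := hre.exists_walk_length_eq_dist
        exact ⟨p.mapLe hHF, by rw [Walk.length_map, hp, hd]⟩
      have := Set.ncard_le_ncard hsub (Set.toFinite _)
      omega
    · push Not at hdeg
      obtain ⟨x, hx, hx3⟩ := hdeg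
      have hcard : (W \ {x}).ncard + 1 = W.ncard := Set.ncard_sdiff_singleton_add_one hx
      have h1 := ihW (W \ {x}).ncard (by omega) (W \ {x}) rfl
      have h2 : edgesIn (F ⊔ edge u v) W ⊆ edgesIn (F ⊔ edge u v) (W \ {x}) ∪
          (fun y => s(x, y)) '' {y ∈ W | (F ⊔ edge u v).Adj x y} := by
        rintro e ⟨he, heW⟩
        by_cases hxe : x ∈ e
        · right
          obtain ⟨y, rfl⟩ := hxe
          exact ⟨y, ⟨heW y (by simp), he⟩, rfl⟩
        · left
          refine ⟨he, fun z hz => ⟨heW z hz, ?_⟩⟩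
          rintro rfl
          exact hxe hz
      have h3 := Set.ncard_le_ncard h2 (Set.toFinite _)
      have h4 := Set.ncard_union_le (edgesIn (F ⊔ edge u v) (W \ {x}))
        ((fun y => s(x, y)) '' {y ∈ W | (F ⊔ edge u v).Adj x y})
      have h5 := Set.ncard_image_le (f := fun y => s(x, y))
        (Set.toFinite {y ∈ W | (F ⊔ edge u v).Adj x y})
      omega

theorem Sparse.card_edgeSet_le [Fintype V] {R g : ℕ} (hg : g ≤ 2 ^ R) {F : SimpleGraph V}
    (h : Sparse R g F) : F.edgeSet.ncard ≤ 2 * Fintype.card V := by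
  have := h.card_edgesIn_le hg Set.univ
  simpa [edgesIn, Set.ncard_univ] using this

end HighGirth

end CoverageDesign

namespace CoverageDesign

open SimpleGraph

/-! ### Links between terminals -/

section Budget

variable {V : Type*} {G : SimpleGraph V}

/-- The distance in `G` of the two ends of a pair of vertices. -/
noncomputable def hop (G : SimpleGraph V) : Sym2 V → ℕ :=
  Sym2.lift ⟨G.dist, fun _ _ => SimpleGraph.dist_comm⟩

/-- The terminals in `X` can be connected to the set `S` by links between vertices of `X` and `S`
whose total length, measured by distances in `G`, is at most `b`. -/
def Budget (G : SimpleGraph V) (X S : Set V) (b : ℕ) : Prop :=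
  ∃ E : Finset (Sym2 V),
    (∀ x y, s(x, y) ∈ E → G.Reachable x y ∧ (x ∈ S ∨ x ∈ X)) ∧
    (∀ y ∈ X, ∃ s ∈ S, (fromEdgeSet (E : Set (Sym2 V))).Reachable s y) ∧
    ∑ e ∈ E, hop G e ≤ b

/-- If `S` is extended such that it reaches a new terminal `y`, then one of the links that leave `S`
is no longer needed. -/
theorem Budget.step {X S S' : Set V} {b : ℕ} (h : Budget G X S b) {y : V} (hyX : y ∈ X)
    (hyS : y ∉ S) (hSS' : S ⊆ S') (hyS' : y ∈ S') :
    ∃ a ∈ S, ∃ x ∈ X, x ∉ S ∧ G.Reachable a x ∧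
      ∃ b', G.dist a x + b' ≤ b ∧ Budget G X S' b' := by
  classical
  obtain ⟨E, hE, hconn, hsum⟩ := h
  set N := fromEdgeSet (E : Set (Sym2 V)) with hN
  have hex : ∃ l, ∃ s ∈ S, ∃ p : N.Walk s y, p.length = l := by
    obtain ⟨s, hs, ⟨p⟩⟩ := hconn y hyX
    exact ⟨_, s, hs, p, rfl⟩
  -- on a shortest walk from `S` to `y`, only the first vertex is in `S`
  obtain ⟨s, hs, p, hp⟩ := Nat.find_spec hex
  have hmin : ∀ s' ∈ S, ∀ p' : N.Walk s' y, p.length ≤ p'.length := fun s' hs' p' =>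
    hp ▸ Nat.find_min' hex ⟨s', hs', p', rfl⟩
  clear hp
  cases p with
  | nil => exact absurd hs hyS
  | @cons _ x _ hsx q =>
  have hq : ∀ z ∈ q.support, z ∉ S := by
    intro z hz hzS
    have h1 := hmin z hzS (q.dropUntil z hz)
    have h2 : (q.takeUntil z hz).length + (q.dropUntil z hz).length = q.length := by
      rw [← Walk.length_append, Walk.take_spec]
    rw [Walk.length_cons] at h1
    omega
  have hxS : x ∉ S := hq x q.start_mem_support
  have hsxE : s(s, x) ∈ E := by
    have := hsx
    rw [hN, fromEdgeSet_adj] at this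
    exact this.1
  have hxX : x ∈ X := (hE x s (by rwa [Sym2.eq_swap])).2.resolve_left hxS
  set N' := fromEdgeSet ((E.erase s(s, x) : Finset (Sym2 V)) : Set (Sym2 V)) with hN'
  have hN'adj : ∀ {a c}, N.Adj a c → s(a, c) ≠ s(s, x) → N'.Adj a c := by
    intro a c hac hne
    rw [hN, fromEdgeSet_adj] at hac
    rw [hN', fromEdgeSet_adj]
    exact ⟨Finset.mem_coe.mpr (Finset.mem_erase.mpr ⟨hne, hac.1⟩), hac.2⟩
  have hxy : N'.Reachable x y := by
    refine ⟨q.transfer N' fun e he => ?_⟩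
    induction e using Sym2.ind with
    | _ a c =>
    refine hN'adj (q.adj_of_mem_edges he) fun heq => ?_
    rw [heq] at he
    exact hq s (q.fst_mem_support_of_mem_edges he) hs
  have hsplit : ∀ {w z} (_ : N.Walk w z),
      N'.Reachable w z ∨ N'.Reachable s z ∨ N'.Reachable x z := by
    intro w z r
    induction r with
    | nil => exact .inl (Reachable.refl _)
    | @cons w w' z hww' r ih =>
      rcases ih with ih | ih | ih
      · by_cases heq : s(w, w') = s(s, x)
        · rw [Sym2.eq_iff] at heq
          rcases heq with ⟨-, rfl⟩ | ⟨-, rfl⟩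
          · exact .inr (.inr ih)
          · exact .inr (.inl ih)
        · exact .inl ((hN'adj hww' heq).reachable.trans ih)
      · exact .inr (.inl ih)
      · exact .inr (.inr ih)
  refine ⟨s, hs, x, hxX, hxS, (hE s x hsxE).1, ∑ e ∈ E.erase s(s, x), hop G e, ?_,
    E.erase s(s, x), ?_, ?_, le_rfl⟩
  · have : hop G s(s, x) = G.dist s x := rfl
    rw [← this, Finset.add_sum_erase _ _ hsxE]
    exact hsum
  · intro a c hac
    have := hE a c (Finset.mem_of_mem_erase hac)
    exact ⟨this.1, this.2.imp (fun h => hSS' h) id⟩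
  · intro z hz
    obtain ⟨s', hs', ⟨r⟩⟩ := hconn z hz
    rcases hsplit r with h | h | h
    · exact ⟨s', hSS' hs', h⟩
    · exact ⟨s, hSS' hs, h⟩
    · exact ⟨y, hyS', hxy.symm.trans h⟩

/-- A connected graph with `k` vertices has a closed walk of length at most `2 * k - 2` through all
of them. -/
theorem exists_closed_walk {W : Type*} [Fintype W] {H : SimpleGraph W} (hH : H.Connected) (x : W) :
    ∃ p : H.Walk x x, (∀ w, w ∈ p.support) ∧ p.length + 2 ≤ 2 * Fintype.card W := by
  classical
  have key : ∀ k, 1 ≤ k → k ≤ Fintype.card W →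
      ∃ p : H.Walk x x, k ≤ p.support.toFinset.card ∧ p.length + 2 ≤ 2 * k := by
    intro k hk
    induction k, hk using Nat.le_induction with
    | base => exact fun _ => ⟨.nil, by simp, by simp⟩
    | succ k hk ih =>
      intro hkW
      obtain ⟨p, hp, hlen⟩ := ih (by omega)
      by_cases hlt : k + 1 ≤ p.support.toFinset.card
      · exact ⟨p, hlt, by omega⟩
      have : ∃ z, z ∉ p.support.toFinset := by
        by_contra! hall
        rw [Finset.eq_univ_of_forall hall, Finset.card_univ] at hlt
        exact hlt hkW
      obtain ⟨z, hz⟩ := this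
      obtain ⟨q⟩ := hH.preconnected x z
      obtain ⟨d, -, hd1, hd2⟩ := q.exists_boundary_dart {w | w ∈ p.support}
        p.start_mem_support (fun h => hz (List.mem_toFinset.mpr h))
      -- a detour to the new vertex and back
      refine ⟨(p.takeUntil d.fst hd1).append
        (.cons d.adj (.cons d.adj.symm (p.dropUntil d.fst hd1))), ?_, ?_⟩
      · have hsub : insert d.snd p.support.toFinset ⊆ ((p.takeUntil d.fst hd1).append
            (.cons d.adj (.cons d.adj.symm (p.dropUntil d.fst hd1)))).support.toFinset := by
          intro w hw
          rw [List.mem_toFinset, Walk.mem_support_append_iff]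
          rw [Finset.mem_insert, List.mem_toFinset] at hw
          rcases hw with rfl | hw
          · simp
          · rw [← p.take_spec hd1, Walk.mem_support_append_iff] at hw
            rcases hw with hw | hw
            · exact .inl hw
            · right; simp [hw]
        have h1 := Finset.card_le_card hsub
        rw [Finset.card_insert_of_notMem (fun h => hd2 (List.mem_toFinset.mp h))] at h1
        omega
      · have h2 : (p.takeUntil d.fst hd1).length + (p.dropUntil d.fst hd1).length = p.length := by
          rw [← Walk.length_append, Walk.take_spec]
        simp only [Walk.length_append, Walk.length_cons]
        omega
  obtain ⟨p, hp, hlen⟩ := key (Fintype.card W) (Fintype.card_pos_iff.mpr ⟨x⟩) le_rfl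
  refine ⟨p, fun w => ?_, hlen⟩
  have : p.support.toFinset = Finset.univ :=
    Finset.eq_univ_of_card _ (le_antisymm (Finset.card_le_univ _) hp)
  rw [← List.mem_toFinset, this]
  exact Finset.mem_univ w

/-- The links join terminals that follow one another on the walk; `t` is the first terminal
on the walk. -/
theorem exists_links_of_walk {X : Set V} {z x : V} (p : G.Walk z x) (hx : x ∈ X) :
    ∃ E : Finset (Sym2 V), ∃ t ∈ X, (∀ a c, s(a, c) ∈ E → G.Reachable a c ∧ a ∈ X) ∧
      G.Reachable z t ∧
      (∀ y ∈ X, y ∈ p.support → (fromEdgeSet (E : Set (Sym2 V))).Reachable t y) ∧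
      ∑ e ∈ E, hop G e + G.dist z t ≤ p.length := by
  classical
  induction p with
  | nil => exact ⟨∅, _, hx, by simp, Reachable.refl _, by simp [eq_comm], by simp⟩
  | @cons z z' x h p ih =>
    obtain ⟨E, t, ht, hE, hre, hcon, hsum⟩ := ih hx
    have htri : G.dist z t ≤ 1 + G.dist z' t := by
      obtain ⟨q, hq⟩ := hre.exists_walk_length_eq_dist
      have := dist_le (Walk.cons h q)
      rw [Walk.length_cons] at this
      omega
    have hzt : G.Reachable z t := h.reachable.trans hre
    by_cases hz : z ∈ X
    · refine ⟨insert s(z, t) E, z, hz, ?_, Reachable.refl _, ?_, ?_⟩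
      · intro a c hac
        rw [Finset.mem_insert, Sym2.eq_iff] at hac
        rcases hac with (⟨rfl, rfl⟩ | ⟨rfl, rfl⟩) | hac
        · exact ⟨hzt, hz⟩
        · exact ⟨hzt.symm, ht⟩
        · exact hE a c hac
      · intro y hy hyp
        rw [Walk.support_cons, List.mem_cons] at hyp
        rcases hyp with rfl | hyp
        · exact Reachable.refl _
        · have h1 : (fromEdgeSet ((insert s(z, t) E : Finset (Sym2 V)) : Set (Sym2 V))).Reachable
              z t := by
            by_cases hzt' : z = t
            · rw [hzt']
            · exact Adj.reachable (by rw [fromEdgeSet_adj]; exact ⟨by simp, hzt'⟩)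
          exact h1.trans ((hcon y hy hyp).mono (fromEdgeSet_mono (by simp)))
      · have h1 : ∑ e ∈ insert s(z, t) E, hop G e ≤ hop G s(z, t) + ∑ e ∈ E, hop G e := by
          by_cases hmem : s(z, t) ∈ E
          · rw [Finset.insert_eq_of_mem hmem]; omega
          · rw [Finset.sum_insert hmem]
        have h2 : hop G s(z, t) = G.dist z t := rfl
        rw [SimpleGraph.dist_self, Walk.length_cons]
        omega
    · refine ⟨E, t, ht, hE, hzt, ?_, ?_⟩
      · intro y hy hyp
        rw [Walk.support_cons, List.mem_cons] at hyp
        rcases hyp with rfl | hyp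
        · exact absurd hy hz
        · exact hcon y hy hyp
      · rw [Walk.length_cons]
        omega

theorem ncard_edgeSet_coe (T : G.Subgraph) : Nat.card T.coe.edgeSet = T.edgeSet.ncard := by
  rw [Nat.card_coe_set_eq, ← T.image_coe_edgeSet_coe,
    Set.ncard_image_of_injective _ (Sym2.map.injective Subtype.val_injective)]

/-- Walking around a tree, along every edge twice, one meets all terminals. -/
theorem budget_of_isTree [Fintype V] {T : G.Subgraph} (hT : T.coe.IsTree) {X : Set V}
    (hX : X ⊆ T.verts) {x : V} (hx : x ∈ X) : Budget G X {x} (2 * T.edgeSet.ncard) := by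
  classical
  obtain ⟨p, hp, hlen⟩ := exists_closed_walk hT.connected ⟨x, hX hx⟩
  obtain ⟨E, t, ht, hE, -, hcon, hsum⟩ := exists_links_of_walk (p.map T.hom) hx
  have hcard : Nat.card T.coe.edgeSet + 1 = Nat.card T.verts :=
    (isTree_iff_connected_and_card.mp hT).2
  rw [ncard_edgeSet_coe, Nat.card_eq_fintype_card] at hcard
  rw [Walk.length_map] at hsum
  have hsupp : ∀ y ∈ X, y ∈ (p.map T.hom).support := by
    intro y hy
    rw [Walk.support_map, List.mem_map]
    exact ⟨⟨y, hX hy⟩, hp _, rfl⟩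
  refine ⟨E, fun a c hac => ⟨(hE a c hac).1, .inr (hE a c hac).2⟩, fun y hy => ⟨x, rfl, ?_⟩, ?_⟩
  · exact (hcon x hx (hsupp x hx)).symm.trans (hcon y hy (hsupp y hy))
  · omega

end Budget

/-! ### Growing a tree -/

section Growth

variable {V : Type*} {G : SimpleGraph V}

/-- All but `k` of the edges of `F` form a sparse graph. -/
def Charged (R g : ℕ) (F : SimpleGraph V) (k : ℕ) : Prop :=
  ∃ F₀ : SimpleGraph V, Sparse R g F₀ ∧ F₀ ≤ F ∧ F.edgeSet.ncard ≤ F₀.edgeSet.ncard + k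

/-- `T` is a tree that consists of edges of `F`. The edges that were added to `F` while a vertex `v`
with at least `g` vertices in its ball was reached are paid by the set `A` of
vertices near `T`, which contains all these balls; they are disjoint. The number `c` is the
contribution of former trees. -/
structure Growth (R g c : ℕ) (F : SimpleGraph V) (T : G.Subgraph) : Prop where
  le : F ≤ G
  conn : T.Connected
  card : T.edgeSet.ncard + 1 = T.verts.ncard
  sub : ∀ a b, T.Adj a b → F.Adj a b
  charge : ∃ (k : ℕ) (A : Set V), Charged R g F k ∧ g * k ≤ c + A.ncard ∧
    ∀ a ∈ A, ∃ x ∈ T.verts, a ∈ ball F R x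

theorem Growth.isTree [Finite V] {R g c : ℕ} {F : SimpleGraph V} {T : G.Subgraph}
    (h : Growth R g c F T) : T.coe.IsTree := by
  rw [isTree_iff_connected_and_card, ncard_edgeSet_coe, Nat.card_coe_set_eq]
  exact ⟨h.conn.coe, h.card⟩

/-- A new tree starts with a single vertex, and no vertex has paid for it. -/
theorem Growth.start {R g c k : ℕ} {F : SimpleGraph V} (hF : F ≤ G) (hk : Charged R g F k)
    (hc : g * k ≤ c) (v : V) : Growth R g c F (G.singletonSubgraph v) where
  le := hF
  conn := Subgraph.singletonSubgraph_connected
  card := by simp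
  sub := by simp
  charge := ⟨k, ∅, hk, by simpa using hc, by simp⟩

theorem edgeSet_sup_edge {F : SimpleGraph V} {u v : V} (huv : u ≠ v) :
    (F ⊔ edge u v).edgeSet = insert s(u, v) F.edgeSet := by
  rw [edgeSet_sup, edgeSet_edge_of_ne huv, Set.union_comm, Set.singleton_union]

/-- A tree may grow by an edge that has been bought before, or to a vertex that is far away in `F`.
In the second case, the edge is either added to the sparse part of `F`, or paid by the
ball around the new vertex. -/
theorem Growth.grow [Finite V] {R g c : ℕ} {F : SimpleGraph V} {T : G.Subgraph}
    (h : Growth R g c F T) {u v : V} (hu : u ∈ T.verts) (hv : v ∉ T.verts) (huv : G.Adj u v)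
    (hfar : F.Adj u v ∨ ∀ x ∈ T.verts, ∀ p : F.Walk x v, 2 * R + 2 ≤ p.length) :
    Growth R g c (F ⊔ edge u v) (T ⊔ G.subgraphOfAdj huv) where
  le := by
    refine sup_le h.le ?_
    intro a b hab
    rw [edge_adj] at hab
    rcases hab with ⟨⟨rfl, rfl⟩ | ⟨rfl, rfl⟩, -⟩
    · exact huv
    · exact huv.symm
  conn := Subgraph.connected_sup h.conn.preconnected
    (Subgraph.subgraphOfAdj_connected huv).preconnected ⟨u, by simp [hu]⟩
  card := by
    have h1 : (T ⊔ G.subgraphOfAdj huv).edgeSet = insert s(u, v) T.edgeSet := by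
      rw [Subgraph.edgeSet_sup, edgeSet_subgraphOfAdj, Set.union_comm, Set.singleton_union]
    have h2 : (T ⊔ G.subgraphOfAdj huv).verts = insert v T.verts := by
      ext w
      simp only [Subgraph.verts_sup, subgraphOfAdj_verts, Set.mem_union, Set.mem_insert_iff,
        Set.mem_singleton_iff]
      constructor
      · rintro (h | rfl | rfl) <;> tauto
      · tauto
    rw [h1, h2, Set.ncard_insert_of_notMem (a := s(u, v))
      (fun hmem => hv (T.edge_vert (Subgraph.Adj.symm hmem))) (Set.toFinite _),
      Set.ncard_insert_of_notMem hv (Set.toFinite _), h.card]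
  sub := by
    intro a b hab
    rw [Subgraph.sup_adj, subgraphOfAdj_adj, Sym2.eq_iff] at hab
    rw [sup_adj, edge_adj]
    rcases hab with hab | ⟨rfl, rfl⟩ | ⟨rfl, rfl⟩
    · exact .inl (h.sub a b hab)
    · exact .inr ⟨.inl ⟨rfl, rfl⟩, huv.ne⟩
    · exact .inr ⟨.inr ⟨rfl, rfl⟩, huv.ne'⟩
  charge := by
    obtain ⟨k, A, ⟨F₀, hF₀, hle, hcard⟩, hk, hA⟩ := h.charge
    have hF : F ≤ F ⊔ edge u v := le_sup_left
    have hA' : ∀ a ∈ A, ∃ x ∈ (T ⊔ G.subgraphOfAdj huv).verts, a ∈ ball (F ⊔ edge u v) R x := by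
      intro a ha
      obtain ⟨x, hx, hax⟩ := hA a ha
      exact ⟨x, by simp [hx], ball_mono hF R x hax⟩
    by_cases hadj : F.Adj u v
    · have hsup : F ⊔ edge u v = F := by
        rw [sup_eq_left]
        intro a b hab
        rw [edge_adj] at hab
        rcases hab with ⟨⟨rfl, rfl⟩ | ⟨rfl, rfl⟩, -⟩
        · exact hadj
        · exact hadj.symm
      exact ⟨k, A, by rw [hsup]; exact ⟨F₀, hF₀, hle, hcard⟩, hk, hA'⟩
    have hfar' := hfar.resolve_left hadj
    have hnew : (F ⊔ edge u v).edgeSet.ncard = F.edgeSet.ncard + 1 := by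
      rw [edgeSet_sup_edge huv.ne, Set.ncard_insert_of_notMem (a := s(u, v)) hadj (Set.toFinite _)]
    by_cases hlight : (ball F R v).ncard < g
    · refine ⟨k, A, ⟨F₀ ⊔ edge u v, .add hF₀ huv.ne ?_ ?_, sup_le_sup_right hle _, ?_⟩, hk, hA'⟩
      · intro p
        simpa using hfar' u hu (p.mapLe hle)
      · exact (Set.ncard_le_ncard (ball_mono hle R v) (Set.toFinite _)).trans_lt hlight
      · rw [hnew, edgeSet_sup_edge huv.ne,
          Set.ncard_insert_of_notMem (a := s(u, v)) (fun hm => hadj (hle hm)) (Set.toFinite _)]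
        omega
    · refine ⟨k + 1, A ∪ ball F R v, ⟨F₀, hF₀, hle.trans hF, by omega⟩, ?_, ?_⟩
      · have hdis : Disjoint A (ball F R v) := by
          rw [Set.disjoint_left]
          rintro a ha ⟨q, hq⟩
          obtain ⟨x, hx, p, hp⟩ := hA a ha
          have := hfar' x hx (p.append q.reverse)
          simp at this
          omega
        rw [Set.ncard_union_eq hdis (Set.toFinite _) (Set.toFinite _), mul_add]
        omega
      · rintro a (ha | ha)
        · exact hA' a ha
        · exact ⟨v, by simp, ball_mono hF R v ha⟩

/-- At the end, at most `n` vertices have paid for the tree. -/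
theorem Growth.charged [Fintype V] {R g c : ℕ} {F : SimpleGraph V} {T : G.Subgraph}
    (h : Growth R g c F T) : ∃ k, Charged R g F k ∧ g * k ≤ c + Fintype.card V := by
  obtain ⟨k, A, hk, hA, -⟩ := h.charge
  refine ⟨k, hk, hA.trans ?_⟩
  have := Set.ncard_le_ncard (Set.subset_univ A)
  rw [Set.ncard_univ, Nat.card_eq_fintype_card] at this
  omega

theorem Charged.card_edgeSet_le [Fintype V] {R g k : ℕ} (hg : g ≤ 2 ^ R) {F : SimpleGraph V}
    (h : Charged R g F k) : F.edgeSet.ncard ≤ 2 * Fintype.card V + k := by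
  obtain ⟨F₀, hF₀, -, hcard⟩ := h
  have := hF₀.card_edgeSet_le hg
  omega

end Growth

end CoverageDesign

namespace CoverageDesign

open SimpleGraph RAM

/-! ### The program -/

section Program

open RAM.Expr RAM.Cmd

/-! The registers `0`, `1` and the arrays `0`, `1` hold the instance. Register `4` holds the length
of edges that have not been bought, register `5` a number that serves as infinity, register `20`
the current commodity `j`. Array `3` is the output. Array `4` holds, for each edge that has been
bought, the amount by which this shortens the edge. Row `j` of array `5` marks the vertices of the
tree of commodity `j`. The rows `0` of the arrays `6` and `7` hold the distances from the terminals
outside the tree, and the parent pointers of shortest paths towards them. -/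

/-- Puts `2 * R + 2` in register `4`, where `2 ^ R` is the first power of two that is at
least the number of commodities. -/
def lengthProg : Cmd :=
  seq (assign 3 (lit 1)) <| seq (assign 4 (lit 2)) <| loop 10 1 <|
    when (sub (reg 1) (reg 3)) <|
      seq (assign 3 (add (reg 3) (reg 3))) (assign 4 (add (reg 4) (lit 2)))

/-- Puts a number in register `5` that is greater than all finite distances. -/
def infProg : Cmd :=
  seq (assign 5 (lit 1)) <| loop 10 0 <| assign 5 (add (reg 5) (reg 4))

/-- Puts a terminal of the current commodity, if there is any, in register `6`, and
marks it as the first vertex of the tree. -/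
def rootProg : Cmd :=
  seq (assign 6 (lit 0)) <|
  seq (loop 27 0 <| when (cell 1 (reg 20) (reg 27)) (assign 6 (reg 27))) <|
  write 5 (reg 20) (reg 6) (lit 1)

/-- The initial distances from the terminals which are not yet in the tree. -/
def initProg : Cmd :=
  loop 27 0 <| seq (write 6 (lit 0) (reg 27) (reg 5)) <|
    when (sub (cell 1 (reg 20) (reg 27)) (cell 5 (reg 20) (reg 27)))
      (write 6 (lit 0) (reg 27) (lit 0))

/-- The distance to the vertex in register `26`, plus the length of the edge from there to the
vertex in register `25`. -/
def viaExpr : Expr :=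
  add (cell 6 (lit 0) (reg 26)) (sub (reg 4) (cell 4 (reg 25) (reg 26)))

/-- Tries to improve the distance of the vertex in register `25` through the vertex in
register `26`. -/
def relaxProg : Cmd :=
  when (cell 0 (reg 25) (reg 26)) <| when (sub (cell 6 (lit 0) (reg 25)) viaExpr) <|
    seq (write 6 (lit 0) (reg 25) viaExpr) (write 7 (lit 0) (reg 25) (reg 26))

/-- One round of the Bellman–Ford algorithm. -/
def sweepProg : Cmd :=
  loop 25 0 <| loop 26 0 relaxProg

/-- The Bellman–Ford algorithm, with so many rounds that it stops when no edge can
be relaxed. -/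
def distProg : Cmd :=
  loop 22 0 <| loop 23 0 <| loop 24 1 <| seq sweepProg <| seq sweepProg sweepProg

/-- Puts the vertex of the tree with the least distance in register `6`, and its distance in
register `8`. -/
def selectProg : Cmd :=
  seq (assign 8 (reg 5)) <| loop 27 0 <| when (cell 5 (reg 20) (reg 27)) <|
    when (sub (reg 8) (cell 6 (lit 0) (reg 27))) <|
      seq (assign 8 (cell 6 (lit 0) (reg 27))) (assign 6 (reg 27))

/-- Adds the next vertex of the shortest path to the tree, and buys the edge to it. -/
def stepProg : Cmd :=
  seq (assign 7 (cell 7 (lit 0) (reg 6))) <|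
  seq (write 3 (reg 20) (reg 7) (add (reg 6) (lit 1))) <|
  seq (write 5 (reg 20) (reg 7) (lit 1)) <|
  seq (write 4 (reg 6) (reg 7) (sub (reg 4) (lit 1))) <|
  seq (write 4 (reg 7) (reg 6) (sub (reg 4) (lit 1))) <|
  assign 6 (reg 7)

/-- Walks along the shortest path until a terminal is reached. -/
def walkProg : Cmd :=
  loop 27 0 <| when (cell 6 (lit 0) (reg 6)) stepProg

/-- Connects the terminal that is nearest to the tree. -/
def roundProg : Cmd :=
  seq initProg <| seq distProg <| seq selectProg <| when (sub (reg 5) (reg 8)) walkProg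

/-- The tree of the commodity in register `20`. -/
def treeProg : Cmd :=
  seq rootProg <| loop 21 0 roundProg

/-- The approximation algorithm. -/
def mainProg : Cmd :=
  seq lengthProg <| seq infProg <| loop 20 1 treeProg

theorem mainProg_ok : mainProg.ok = true := by decide

end Program

/-! ### Shortest path labels -/

section Labels

variable {V : Type*}

/-- The length of the edge `uv`, when the edges of `F` have been bought. -/
noncomputable def len (F : SimpleGraph V) (lam : ℕ) (u v : V) : ℕ :=
  open Classical in if F.Adj u v then 1 else lam

theorem one_le_len {F : SimpleGraph V} {lam : ℕ} (h : 1 ≤ lam) (u v : V) : 1 ≤ len F lam u v := by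
  unfold len; split <;> omega

theorem len_le {F : SimpleGraph V} {lam : ℕ} (h : 1 ≤ lam) (u v : V) : len F lam u v ≤ lam := by
  unfold len; split <;> omega

/-- The distances `d` from `Y` which the Bellman–Ford algorithm maintains:
a vertex with a finite distance that is not in `Y` has a neighbour, given by `q`, that
justifies the distance. -/
structure Labels {n : ℕ} (G : SimpleGraph (Fin n)) (w : Fin n → Fin n → ℕ) (Y : Set (Fin n))
    (inf : ℕ) (d q : Fin n → ℕ) : Prop where
  source : ∀ v ∈ Y, d v = 0
  le : ∀ v, d v ≤ inf
  par : ∀ v, d v = inf ∨ v ∈ Y ∨ ∃ u : Fin n, q v = u ∧ G.Adj v u ∧ d u + w v u ≤ d v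

/-- No edge can be relaxed. -/
def Tight (G : SimpleGraph V) (w : V → V → ℕ) (d : V → ℕ) : Prop :=
  ∀ u v, G.Adj u v → d u ≤ d v + w u v

theorem Labels.relax {n : ℕ} {G : SimpleGraph (Fin n)} {w : Fin n → Fin n → ℕ} {Y : Set (Fin n)}
    {inf : ℕ} {d q : Fin n → ℕ} (h : Labels G w Y inf d q) {u v : Fin n} (huv : G.Adj u v)
    (hlt : d v + w u v < d u) :
    Labels G w Y inf (Function.update d u (d v + w u v)) (Function.update q u v) where
  source x hx := by
    have hxu : x ≠ u := by
      rintro rfl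
      have := h.source x hx
      omega
    rw [Function.update_of_ne hxu]
    exact h.source x hx
  le x := by
    have := h.le u
    by_cases hxu : x = u
    · subst hxu; rw [Function.update_self]; omega
    · rw [Function.update_of_ne hxu]; exact h.le x
  par x := by
    have hle : ∀ y, Function.update d u (d v + w u v) y ≤ d y := by
      intro y
      by_cases hyu : y = u
      · subst hyu; rw [Function.update_self]; omega
      · rw [Function.update_of_ne hyu]
    by_cases hxu : x = u
    · subst hxu
      refine .inr (.inr ⟨v, by rw [Function.update_self], huv, ?_⟩)
      rw [Function.update_self, Function.update_of_ne huv.ne']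
    · rw [Function.update_of_ne hxu, Function.update_of_ne hxu]
      rcases h.par x with h1 | h1 | ⟨y, h1, h2, h3⟩
      · exact .inl h1
      · exact .inr (.inl h1)
      · exact .inr (.inr ⟨y, h1, h2, by have := hle y; omega⟩)

theorem Tight.le_add_mul_length {G : SimpleGraph V} {w : V → V → ℕ} {d : V → ℕ}
    (h : Tight G w d) {lam : ℕ} (hw : ∀ u v, w u v ≤ lam) {x y : V} (p : G.Walk x y) :
    d x ≤ d y + lam * p.length := by
  induction p with
  | nil => simp
  | @cons x z y hxz p ih =>
    have h1 := h x z hxz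
    have h2 := hw x z
    rw [Walk.length_cons, mul_add]
    omega

theorem Tight.le_add_mul_dist {G : SimpleGraph V} {w : V → V → ℕ} {d : V → ℕ}
    (h : Tight G w d) {lam : ℕ} (hw : ∀ u v, w u v ≤ lam) {x y : V} (hxy : G.Reachable x y) :
    d x ≤ d y + lam * G.dist x y := by
  obtain ⟨p, hp⟩ := hxy.exists_walk_length_eq_dist
  rw [← hp]
  exact h.le_add_mul_length hw p

end Labels

/-! ### Correctness of the Bellman–Ford algorithm -/

section Memory

variable {n g : ℕ} {G F : SimpleGraph (Fin n)} {X : Fin g → Finset (Fin n)} {lam : ℕ} {s s' : Store}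

/-- The distances in the memory. -/
def dst (s : Store) (v : Fin n) : ℕ := s.arr 6 0 v

/-- The parent pointers of the shortest paths in the memory. -/
def ptr (s : Store) (v : Fin n) : ℕ := s.arr 7 0 v

/-- The memory holds the instance, the constants, and the set of edges that have been bought. -/
structure Ctx (G F : SimpleGraph (Fin n)) (X : Fin g → Finset (Fin n)) (lam : ℕ) (s : Store) :
    Prop where
  reg0 : s.reg 0 = n
  reg1 : s.reg 1 = g
  reg4 : s.reg 4 = lam
  reg5 : s.reg 5 = n * lam + 1
  adj : ∀ u v : Fin n, s.arr 0 u v ≠ 0 ↔ G.Adj u v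
  term : ∀ (j : Fin g) (v : Fin n), s.arr 1 j v = if v ∈ X j then 1 else 0
  bought : ∀ u v : Fin n, s.arr 4 u v = open Classical in if F.Adj u v then lam - 1 else 0

theorem Ctx.congr (h : Ctx G F X lam s) (hr : ∀ r ∈ [0, 1, 4, 5], s'.reg r = s.reg r)
    (ha : ∀ a ∈ [0, 1, 4], s'.arr a = s.arr a) : Ctx G F X lam s' where
  reg0 := (hr 0 (by simp)).trans h.reg0
  reg1 := (hr 1 (by simp)).trans h.reg1
  reg4 := (hr 4 (by simp)).trans h.reg4
  reg5 := (hr 5 (by simp)).trans h.reg5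
  adj := by rw [ha 0 (by simp)]; exact h.adj
  term := by rw [ha 1 (by simp)]; exact h.term
  bought := by rw [ha 4 (by simp)]; exact h.bought

/-- The command `p` leaves the instance, the constants and the bought edges alone. -/
def Keeps (p : Cmd) : Bool :=
  [0, 1, 4, 5].all (fun r => decide (r ∉ p.regs)) && [0, 1, 4].all (fun a => decide (a ∉ p.arrs))

theorem Ctx.frame (h : Ctx G F X lam s) {p : Cmd} (hp : Keeps p = true) (hf : Cmd.Frame p s s') :
    Ctx G F X lam s' := by
  simp only [Keeps, Bool.and_eq_true, List.all_eq_true, decide_eq_true_eq] at hp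
  exact h.congr (fun r hr => hf.1 r (hp.1 r hr)) fun a ha => hf.2 a (hp.2 a ha)

theorem Ctx.len_eq (h : Ctx G F X lam s) (hlam : 1 ≤ lam) (u v : Fin n) :
    s.reg 4 - s.arr 4 u v = len F lam u v := by
  rw [h.reg4, h.bought, len]
  split <;> omega

variable {Y : Set (Fin n)}

theorem relaxProg_spec (h : Ctx G F X lam s) (hlam : 1 ≤ lam) {u v : Fin n} (hu : s.reg 25 = u)
    (hv : s.reg 26 = v) (hL : Labels G (len F lam) Y (n * lam + 1) (dst s) (ptr s)) :
    Labels G (len F lam) Y (n * lam + 1) (dst (relaxProg.den s)) (ptr (relaxProg.den s)) ∧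
    ((dst (n := n) (relaxProg.den s) = dst s ∧ (G.Adj u v → dst s u ≤ dst s v + len F lam u v)) ∨
      (¬ Tight G (len F lam) (dst s) ∧
        ∑ x : Fin n, dst (relaxProg.den s) x < ∑ x : Fin n, dst s x)) := by
  have hvia : viaExpr.val s = dst s v + len F lam u v := by
    simp only [viaExpr, Expr.val, hu, hv, h.len_eq hlam, dst]
  unfold relaxProg
  simp only [Cmd.den, Expr.val, hu, hv, hvia]
  split
  · next h0 =>
    refine ⟨hL, .inl ⟨rfl, fun hadj => absurd h0 ((h.adj u v).mpr hadj)⟩⟩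
  · next h0 =>
    have hadj := (h.adj u v).mp h0
    split
    · next h1 =>
      exact ⟨hL, .inl ⟨rfl, fun _ => Nat.sub_eq_zero_iff_le.mp h1⟩⟩
    · next h1 =>
      have hlt : dst s v + len F lam u v < dst s u := by
        have : s.arr 6 0 u = dst s u := rfl
        omega
      simp only [Store.setCell_reg, hu, hv]
      set s' := (s.setCell 6 0 ↑u (dst s v + len F lam u v)).setCell 7 0 ↑u v with hs'
      have hd : dst (n := n) s' = Function.update (dst s) u (dst s v + len F lam u v) := by
        funext x
        simp [hs', dst, Function.update_apply, Fin.val_inj]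
      have hq : ptr (n := n) s' = Function.update (ptr s) u v := by
        funext x
        simp [hs', ptr, Function.update_apply, Fin.val_inj]
      rw [hd, hq]
      refine ⟨hL.relax hadj hlt, .inr ⟨fun ht => ?_, ?_⟩⟩
      · have := ht u v hadj
        omega
      · refine Finset.sum_lt_sum (fun x _ => ?_) ⟨u, Finset.mem_univ u, ?_⟩
        · by_cases hxu : x = u
          · subst hxu; rw [Function.update_self]; exact hlt.le
          · rw [Function.update_of_ne hxu]
        · rw [Function.update_self]; exact hlt

theorem sweepProg_spec (h : Ctx G F X lam s) (hlam : 1 ≤ lam)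
    (hL : Labels G (len F lam) Y (n * lam + 1) (dst s) (ptr s)) :
    Labels G (len F lam) Y (n * lam + 1) (dst (sweepProg.den s)) (ptr (sweepProg.den s)) ∧
    ((dst (n := n) (sweepProg.den s) = dst s ∧ Tight G (len F lam) (dst s)) ∨
      (¬ Tight G (len F lam) (dst s) ∧
        ∑ x : Fin n, dst (sweepProg.den s) x < ∑ x : Fin n, dst s x)) := by
  have main := Cmd.loop_induction (r := 25) (b := 0) (p := .loop 26 0 relaxProg) (s := s)
    (fun k s' => Labels G (len F lam) Y (n * lam + 1) (dst s') (ptr s') ∧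
      ((dst (n := n) s' = dst s ∧
          ∀ u v : Fin n, u < k → G.Adj u v → dst s u ≤ dst s v + len F lam u v) ∨
        (¬ Tight G (len F lam) (dst s) ∧ ∑ x : Fin n, dst s' x < ∑ x : Fin n, dst s x)))
    (by decide) ⟨hL, .inl ⟨rfl, by simp⟩⟩ ?_
  · rw [h.reg0] at main
    refine ⟨main.1, main.2.imp (fun h => ⟨h.1, fun u v => h.2 u v u.isLt⟩) id⟩
  intro k s₁ hk hrk hf₁ ⟨hL₁, hI₁⟩
  rw [h.reg0] at hk
  have h₁ : Ctx G F X lam s₁ := h.frame (by decide) hf₁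
  have inner := Cmd.loop_induction (r := 26) (b := 0) (p := relaxProg) (s := s₁)
    (fun l s' => Labels G (len F lam) Y (n * lam + 1) (dst s') (ptr s') ∧
      ((dst (n := n) s' = dst s₁ ∧
          ∀ v : Fin n, v < l → G.Adj ⟨k, hk⟩ v →
            dst s₁ ⟨k, hk⟩ ≤ dst s₁ v + len F lam ⟨k, hk⟩ v) ∨
        (¬ Tight G (len F lam) (dst s₁) ∧ ∑ x : Fin n, dst s' x < ∑ x : Fin n, dst s₁ x)))
    (by decide) ⟨hL₁, .inl ⟨rfl, by simp⟩⟩ ?_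
  · rw [h₁.reg0] at inner
    refine ⟨inner.1, ?_⟩
    change (dst (n := n) ((Cmd.loop 26 0 relaxProg).den s₁) = dst s ∧ _) ∨
      (_ ∧ ∑ x : Fin n, dst ((Cmd.loop 26 0 relaxProg).den s₁) x < _)
    rcases hI₁ with ⟨e₁, t₁⟩ | ⟨e₁, t₁⟩
    · rw [e₁] at inner
      rcases inner.2 with ⟨e₂, t₂⟩ | ⟨e₂, t₂⟩
      · refine .inl ⟨e₂, fun u v hu huv => ?_⟩
        rcases Nat.lt_succ_iff_lt_or_eq.mp hu with hu | hu
        · exact t₁ u v hu huv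
        · obtain rfl : u = ⟨k, hk⟩ := Fin.ext hu
          exact t₂ v v.isLt huv
      · exact .inr ⟨e₂, t₂⟩
    · refine .inr ⟨e₁, ?_⟩
      rcases inner.2 with ⟨e₂, t₂⟩ | ⟨e₂, t₂⟩
      · rwa [e₂]
      · exact t₂.trans t₁
  intro l s₂ hl hrl hf₂ ⟨hL₂, hI₂⟩
  rw [h₁.reg0] at hl
  have h₂ : Ctx G F X lam s₂ := h₁.frame (by decide) hf₂
  have h25 : s₂.reg 25 = k := (hf₂.1 25 (by decide)).trans hrk
  obtain ⟨hL₃, hI₃⟩ := relaxProg_spec h₂ hlam (u := ⟨k, hk⟩) (v := ⟨l, hl⟩) h25 hrl hL₂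
  refine ⟨hL₃, ?_⟩
  change (dst (n := n) (relaxProg.den s₂) = dst s₁ ∧ _) ∨
    (_ ∧ ∑ x : Fin n, dst (relaxProg.den s₂) x < _)
  rcases hI₂ with ⟨e₁, t₁⟩ | ⟨e₁, t₁⟩
  · rw [e₁] at hI₃
    rcases hI₃ with ⟨e₂, t₂⟩ | ⟨e₂, t₂⟩
    · refine .inl ⟨e₂, fun v hv huv => ?_⟩
      rcases Nat.lt_succ_iff_lt_or_eq.mp hv with hv | hv
      · exact t₁ v hv huv
      · obtain rfl : v = ⟨l, hl⟩ := Fin.ext hv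
        exact t₂ huv
    · exact .inr ⟨e₂, t₂⟩
  · refine .inr ⟨e₁, ?_⟩
    rcases hI₃ with ⟨e₂, t₂⟩ | ⟨e₂, t₂⟩
    · rwa [e₂]
    · exact t₂.trans t₁

/-- The command `p` relaxes edges, and unless it reaches a state in which no edge can be relaxed,
the sum of all distances drops by at least `q`. -/
def Improves (G F : SimpleGraph (Fin n)) (X : Fin g → Finset (Fin n)) (lam : ℕ) (Y : Set (Fin n))
    (p : Cmd) (q : ℕ) : Prop :=
  ∀ s, Ctx G F X lam s → Labels G (len F lam) Y (n * lam + 1) (dst s) (ptr s) →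
    Labels G (len F lam) Y (n * lam + 1) (dst (p.den s)) (ptr (p.den s)) ∧
    (Tight G (len F lam) (dst s) → Tight G (len F lam) (dst (p.den s))) ∧
    (Tight G (len F lam) (dst (p.den s)) ∨
      ∑ x : Fin n, dst (p.den s) x + q ≤ ∑ x : Fin n, dst s x)

theorem improves_sweepProg (hlam : 1 ≤ lam) : Improves G F X lam Y sweepProg 1 := by
  intro s h hL
  obtain ⟨h1, h2⟩ := sweepProg_spec h hlam hL
  refine ⟨h1, ?_⟩
  rcases h2 with ⟨h2, h3⟩ | ⟨h2, h3⟩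
  · rw [h2]
    exact ⟨id, .inl h3⟩
  · exact ⟨fun h => absurd h h2, .inr h3⟩

theorem Improves.seq {p p' : Cmd} {q q' : ℕ} (hp : Improves G F X lam Y p q)
    (hp' : Improves G F X lam Y p' q') (hk : Keeps p = true) :
    Improves G F X lam Y (.seq p p') (q + q') := by
  intro s h hL
  obtain ⟨h1, h2, h3⟩ := hp s h hL
  obtain ⟨h4, h5, h6⟩ := hp' (p.den s) (h.frame hk (p.frame_den s)) h1
  refine ⟨h4, fun h => h5 (h2 h), ?_⟩
  rcases h3 with h3 | h3
  · exact .inl (h5 h3)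
  · refine h6.imp id fun h6 => ?_
    simp only [Cmd.den]
    omega

theorem Improves.loop {p : Cmd} {q r b N : ℕ} (hp : Improves G F X lam Y p q)
    (hok : (Cmd.loop r b p).ok = true) (hk : Keeps (.loop r b p) = true)
    (hN : ∀ s, Ctx G F X lam s → s.reg b = N) :
    Improves G F X lam Y (.loop r b p) (N * q) := by
  intro s h hL
  have main := Cmd.loop_induction (r := r) (b := b) (p := p) (s := s)
    (fun k s' => Labels G (len F lam) Y (n * lam + 1) (dst s') (ptr s') ∧
      (Tight G (len F lam) (dst s) → Tight G (len F lam) (dst s')) ∧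
      (Tight G (len F lam) (dst s') ∨ ∑ x : Fin n, dst s' x + k * q ≤ ∑ x : Fin n, dst s x))
    hok ⟨hL, id, .inr (by simp [dst])⟩ ?_
  · rwa [hN s h] at main
  intro k s' _ _ hf ⟨h1, h2, h3⟩
  obtain ⟨h4, h5, h6⟩ := hp s' (h.frame hk hf) h1
  refine ⟨h4, fun h => h5 (h2 h), ?_⟩
  rcases h3 with h3 | h3
  · exact .inl (h5 h3)
  · refine h6.imp id fun h6 => ?_
    change ∑ x : Fin n, dst (p.den s') x + _ ≤ _
    rw [add_mul, one_mul]
    omega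

theorem distProg_spec (h : Ctx G F X lam s) (hlam : 1 ≤ lam) (hg : 1 ≤ g) (hlam' : lam ≤ 2 * g)
    (hL : Labels G (len F lam) Y (n * lam + 1) (dst s) (ptr s)) :
    Labels G (len F lam) Y (n * lam + 1) (dst (distProg.den s)) (ptr (distProg.den s)) ∧
    Tight G (len F lam) (dst (distProg.den s)) := by
  have h1 := improves_sweepProg (G := G) (F := F) (X := X) (Y := Y) hlam
  have h2 : Improves G F X lam Y distProg (n * (n * (g * (1 + (1 + 1))))) :=
    (((h1.seq (h1.seq h1 (by decide)) (by decide)).loop (by decide) (by decide)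
      fun s h => h.reg1).loop (by decide) (by decide) fun s h => h.reg0).loop (by decide)
      (by decide) fun s h => h.reg0
  obtain ⟨h3, -, h4⟩ := h2 s h hL
  refine ⟨h3, h4.elim id fun h4 => ?_⟩
  -- otherwise the sum of all distances has dropped by its largest possible value, hence to zero
  have h5 : ∑ x : Fin n, dst s x ≤ n * (n * lam + 1) := by
    refine (Finset.sum_le_card_nsmul _ _ _ fun x _ => hL.le x).trans ?_
    simp
  have h6 : n * (n * lam + 1) ≤ n * (n * (g * (1 + (1 + 1)))) := by
    rcases Nat.eq_zero_or_pos n with hn | hn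
    · simp [hn]
    · refine Nat.mul_le_mul_left n ?_
      nlinarith [Nat.mul_le_mul_left n hlam', Nat.mul_le_mul hn hg]
  have h7 : ∑ x : Fin n, dst (distProg.den s) x = 0 := by omega
  rw [Finset.sum_eq_zero_iff] at h7
  intro u v _
  rw [h7 u (Finset.mem_univ u)]
  exact Nat.zero_le _

end Memory

end CoverageDesign

/-! ### Correctness of the auxiliary programs -/

namespace CoverageDesign

open SimpleGraph RAM

section Blocks

variable {n g : ℕ} {G F : SimpleGraph (Fin n)} {X : Fin g → Finset (Fin n)} {lam : ℕ} {s s' : Store}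

theorem lengthProg_spec (s : Store) :
    ∃ R, (lengthProg.den s).reg 4 = 2 * R + 2 ∧ s.reg 1 ≤ 2 ^ R ∧
      (R = 0 ∨ 2 ^ (R - 1) < s.reg 1) := by
  set s₀ := (s.setReg 3 1).setReg 4 2 with hs₀
  have h1 : s₀.reg 1 = s.reg 1 := by simp [hs₀]
  have main := Cmd.loop_induction (r := 10) (b := 1)
    (p := .when (.sub (.reg 1) (.reg 3)) <|
      .seq (.assign 3 (.add (.reg 3) (.reg 3))) (.assign 4 (.add (.reg 4) (.lit 2)))) (s := s₀)
    (fun k s' => ∃ R, s'.reg 3 = 2 ^ R ∧ s'.reg 4 = 2 * R + 2 ∧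
      (s.reg 1 ≤ 2 ^ R ∨ R = k) ∧ (R = 0 ∨ 2 ^ (R - 1) < s.reg 1))
    (by decide) ⟨0, by simp [hs₀]⟩ ?_
  · obtain ⟨R, -, h2, h3, h4⟩ := main
    refine ⟨R, h2, ?_, h4⟩
    rcases h3 with h3 | rfl
    · exact h3
    · rw [h1]
      exact Nat.lt_two_pow_self.le
  rintro k s' hk hrk hf ⟨R, h3, h4, h5, h6⟩
  have h1' : s'.reg 1 = s.reg 1 := (hf.1 1 (by decide)).trans h1
  simp only [Cmd.den, Expr.val, h1', h3]
  split
  · next h0 =>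
    exact ⟨R, by simpa using h3, by simpa using h4, .inl (by omega), h6⟩
  · next h0 =>
    refine ⟨R + 1, by simp [pow_succ]; ring, by simp [h4]; ring, .inr ?_, .inr ?_⟩
    · rcases h5 with h5 | h5 <;> omega
    · rw [Nat.add_sub_cancel]; omega

theorem infProg_spec (s : Store) :
    (infProg.den s).reg 5 = s.reg 0 * s.reg 4 + 1 := by
  set s₀ := s.setReg 5 1 with hs₀
  have h0 : s₀.reg 0 = s.reg 0 := by simp [hs₀]
  have main := Cmd.loop_induction (r := 10) (b := 0) (p := .assign 5 (.add (.reg 5) (.reg 4)))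
    (s := s₀) (fun k s' => s'.reg 5 = k * s.reg 4 + 1) (by decide) (by simp [hs₀]) ?_
  · rwa [h0] at main
  intro k s' hk hrk hf h5
  have h4 : s'.reg 4 = s.reg 4 := by
    have := hf.1 4 (by decide)
    simpa [hs₀] using this
  simp only [Cmd.den, Expr.val, Store.setReg_reg, h5, h4]
  simp
  ring

/-- The marks in the memory say which vertices are in `S`. -/
def Marks (s : Store) (j : ℕ) (S : Set (Fin n)) : Prop :=
  ∀ v : Fin n, s.arr 5 j v = open Classical in if v ∈ S then 1 else 0

theorem initProg_spec (h : Ctx G F X lam s) {j : Fin g} (hj : s.reg 20 = j) {S : Set (Fin n)}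
    (hS : Marks s j S) :
    Labels G (len F lam) ((X j : Set (Fin n)) \ S) (n * lam + 1) (dst (initProg.den s))
      (ptr (initProg.den s)) := by
  have main := Cmd.loop_induction (r := 27) (b := 0)
    (p := .seq (.write 6 (.lit 0) (.reg 27) (.reg 5)) <|
      .when (.sub (.cell 1 (.reg 20) (.reg 27)) (.cell 5 (.reg 20) (.reg 27)))
        (.write 6 (.lit 0) (.reg 27) (.lit 0))) (s := s)
    (fun k s' => ∀ v : Fin n, v < k → dst s' v = open Classical in
      if v ∈ (X j : Set (Fin n)) \ S then 0 else n * lam + 1) (by decide) (by simp) ?_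
  · rw [h.reg0] at main
    have hd : ∀ v : Fin n, dst (initProg.den s) v = _ := fun v => main v v.isLt
    refine ⟨fun v hv => ?_, fun v => ?_, fun v => ?_⟩
    · rw [hd, if_pos hv]
    · rw [hd]; split <;> omega
    · rw [hd]
      split
      · next hv => exact .inr (.inl hv)
      · exact .inl rfl
  intro k s' hk hrk hf hI v hv
  rw [h.reg0] at hk
  have h' := h.frame (by decide) hf
  have h20 : s'.reg 20 = j := (hf.1 20 (by decide)).trans hj
  have hS' : ∀ v : Fin n, s'.arr 5 j v = open Classical in if v ∈ S then 1 else 0 := by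
    rw [hf.2 5 (by decide)]; exact hS
  have hterm := h'.term j ⟨k, hk⟩
  have hmark := hS' ⟨k, hk⟩
  dsimp only at hterm hmark
  simp only [Cmd.den, Expr.val, Store.setCell_reg, Store.setCell_arr, h20, hrk, h'.reg5]
  simp only [show ((1 : ℕ) = 6) = False by simp, show ((5 : ℕ) = 6) = False by simp, false_and,
    if_false, hterm, hmark]
  rcases Nat.lt_succ_iff_lt_or_eq.mp hv with hv | hv
  · have hne : (v : ℕ) ≠ k := hv.ne
    rw [← hI v hv]
    by_cases h1 : (⟨k, hk⟩ : Fin n) ∈ X j <;> by_cases h2 : (⟨k, hk⟩ : Fin n) ∈ S <;>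
      simp [dst, h1, h2, hne]
  · obtain rfl : v = ⟨k, hk⟩ := Fin.ext hv
    by_cases h1 : (⟨k, hk⟩ : Fin n) ∈ X j <;> by_cases h2 : (⟨k, hk⟩ : Fin n) ∈ S <;>
      simp [dst, h1, h2]

theorem selectProg_spec (h : Ctx G F X lam s) {j : Fin g} (hj : s.reg 20 = j) {S : Set (Fin n)}
    (hS : Marks s j S) :
    ∃ m, (selectProg.den s).reg 8 = m ∧ m ≤ n * lam + 1 ∧ (∀ v ∈ S, m ≤ dst s v) ∧
      (m < n * lam + 1 → ∃ u ∈ S, (selectProg.den s).reg 6 = (u : Fin n) ∧ dst s u = m) := by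
  set s₀ := s.setReg 8 (s.reg 5) with hs₀
  have h0 : Ctx G F X lam s₀ := h.congr (by simp [hs₀]) (by simp [hs₀])
  have main := Cmd.loop_induction (r := 27) (b := 0)
    (p := .when (.cell 5 (.reg 20) (.reg 27)) <|
      .when (.sub (.reg 8) (.cell 6 (.lit 0) (.reg 27))) <|
      .seq (.assign 8 (.cell 6 (.lit 0) (.reg 27))) (.assign 6 (.reg 27))) (s := s₀)
    (fun k s' => s'.reg 8 ≤ n * lam + 1 ∧ (∀ v ∈ S, (v : ℕ) < k → s'.reg 8 ≤ dst s v) ∧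
      (s'.reg 8 < n * lam + 1 → ∃ u ∈ S, s'.reg 6 = (u : Fin n) ∧ dst s u = s'.reg 8))
    (by decide) ⟨by simp [hs₀, h.reg5], by simp, by simp [hs₀, h.reg5]⟩ ?_
  · rw [h0.reg0] at main
    exact ⟨_, rfl, main.1, fun v hv => main.2.1 v hv v.isLt, main.2.2⟩
  rintro k s' hk hrk hf ⟨h1, h2, h3⟩
  rw [h0.reg0] at hk
  have h20 : s'.reg 20 = j := by
    have := hf.1 20 (by decide)
    simpa [hs₀, hj] using this
  have hmark : s'.arr 5 j k = open Classical in if (⟨k, hk⟩ : Fin n) ∈ S then 1 else 0 := by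
    rw [hf.2 5 (by decide)]; exact hS ⟨k, hk⟩
  have hd : s'.arr 6 0 k = dst s (⟨k, hk⟩ : Fin n) := by
    rw [hf.2 6 (by decide)]; rfl
  simp only [Cmd.den, Expr.val, h20, hrk, hmark, hd]
  have hstep : ∀ v : Fin n, (v : ℕ) < k + 1 → (v : ℕ) < k ∨ v = ⟨k, hk⟩ := fun v hv =>
    (Nat.lt_succ_iff_lt_or_eq.mp hv).imp id fun h => Fin.ext h
  by_cases hkS : (⟨k, hk⟩ : Fin n) ∈ S
  · simp only [hkS, if_true, one_ne_zero, if_false]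
    split
    · next hle =>
      refine ⟨by simpa using h1, fun v hv hvk => ?_, by simpa using h3⟩
      rcases hstep v hvk with hvk | rfl
      · simpa using h2 v hv hvk
      · simp; omega
    · next hlt =>
      refine ⟨by simp; omega, fun v hv hvk => ?_, fun _ => ⟨_, hkS, by simp [hrk], by simp⟩⟩
      rcases hstep v hvk with hvk | rfl
      · have := h2 v hv hvk
        simp; omega
      · simp
  · simp only [hkS, if_false, if_true]
    refine ⟨by simpa using h1, fun v hv hvk => ?_, by simpa using h3⟩
    rcases hstep v hvk with hvk | rfl
    · simpa using h2 v hv hvk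
    · exact absurd hv hkS

theorem rootProg_spec (h : Ctx G F X lam s) {j : Fin g} (hj : s.reg 20 = j) (hn : 0 < n)
    (hS : Marks s j (∅ : Set (Fin n))) :
    ∃ x : Fin n, ((X j).Nonempty → x ∈ X j) ∧ Marks (rootProg.den s) j {x} ∧
      ∀ i ≠ (j : ℕ), (rootProg.den s).arr 5 i = s.arr 5 i := by
  set s₀ := s.setReg 6 0 with hs₀
  have h0 : Ctx G F X lam s₀ := h.congr (by simp [hs₀]) (by simp [hs₀])
  set L : Cmd := .loop 27 0 <| .when (.cell 1 (.reg 20) (.reg 27)) (.assign 6 (.reg 27)) with hL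
  have main := Cmd.loop_induction (r := 27) (b := 0)
    (p := .when (.cell 1 (.reg 20) (.reg 27)) (.assign 6 (.reg 27))) (s := s₀)
    (fun k s' => ∃ x : Fin n, s'.reg 6 = x ∧ ((∃ v ∈ X j, (v : ℕ) < k) → x ∈ X j))
    (by decide) ⟨⟨0, hn⟩, by simp [hs₀], by simp⟩ ?_
  · rw [h0.reg0] at main
    obtain ⟨x, hx, hxX⟩ := main
    have hfr := Cmd.frame_den L s₀
    have h20 : (L.den s₀).reg 20 = j := by
      have := hfr.1 20 (by decide)
      simpa [hs₀, hj] using this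
    have h5 : (L.den s₀).arr 5 = s.arr 5 := hfr.2 5 (by decide)
    have hden : rootProg.den s = (L.den s₀).setCell 5 j x 1 := by
      simp only [rootProg, Cmd.den, Expr.val, ← hs₀]
      rw [← hx, ← h20]
      rfl
    refine ⟨x, fun ⟨v, hv⟩ => hxX ⟨v, hv, v.isLt⟩, fun v => ?_, fun i hi => ?_⟩
    · have := hS v
      rw [hden, Store.setCell_arr, h5, this]
      simp [Fin.val_inj]
    · funext v
      rw [hden, Store.setCell_arr, h5]
      simp [hi]
  rintro k s' hk hrk hf ⟨x, hx, hxX⟩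
  rw [h0.reg0] at hk
  have h20 : s'.reg 20 = j := by
    have := hf.1 20 (by decide)
    simpa [hs₀, hj] using this
  have hterm := (h0.frame (by decide) hf).term j ⟨k, hk⟩
  dsimp only at hterm
  simp only [Cmd.den, Expr.val, h20, hrk, hterm]
  by_cases hkX : (⟨k, hk⟩ : Fin n) ∈ X j
  · exact ⟨⟨k, hk⟩, by simp [hkX], fun _ => hkX⟩
  · refine ⟨x, by simpa [hkX] using hx, ?_⟩
    rintro ⟨v, hv, hvk⟩
    rcases Nat.lt_succ_iff_lt_or_eq.mp hvk with hvk | hvk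
    · exact hxX ⟨v, hv, hvk⟩
    · obtain rfl : v = ⟨k, hk⟩ := Fin.ext hvk
      exact absurd hv hkX

end Blocks

end CoverageDesign

/-! ### Adding a shortest path -/

namespace CoverageDesign

open SimpleGraph RAM

section Trees

variable {n g : ℕ} {G F : SimpleGraph (Fin n)} {X : Fin g → Finset (Fin n)} {s s' : Store} {R c : ℕ}

/-- Row `j` of the output holds the tree `T`, in parent-pointer form. -/
structure Row (s : Store) (j : ℕ) (T : G.Subgraph) : Prop where
  adj : ∀ v w, T.Adj v w ↔ s.arr 3 j v = (w : ℕ) + 1 ∨ s.arr 3 j w = (v : ℕ) + 1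
  fresh : ∀ v ∉ T.verts, s.arr 3 j v = 0

/-- The memory while the tree of commodity `j` is being built: so far, it is `T`. -/
structure Building (X : Fin g → Finset (Fin n)) (R c : ℕ) (j : Fin g) (F : SimpleGraph (Fin n))
    (T : G.Subgraph) (s : Store) : Prop where
  ctx : Ctx G F X (2 * R + 2) s
  reg : s.reg 20 = j
  growth : Growth R g c F T
  marks : Marks s j T.verts
  row : Row s j T

/-- Only row `j` of the output and of the marks has changed. -/
def OnlyRow (j : ℕ) (s s' : Store) : Prop :=
  ∀ i ≠ j, s'.arr 3 i = s.arr 3 i ∧ s'.arr 5 i = s.arr 5 i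

theorem OnlyRow.trans {j : ℕ} {s₁ s₂ s₃ : Store} (h : OnlyRow j s₁ s₂) (h' : OnlyRow j s₂ s₃) :
    OnlyRow j s₁ s₃ := fun i hi =>
  ⟨(h' i hi).1.trans (h i hi).1, (h' i hi).2.trans (h i hi).2⟩

theorem Building.frame {j : Fin g} {T : G.Subgraph} (h : Building X R c j F T s) {p : Cmd}
    (hf : Cmd.Frame p s s') (hk : Keeps p = true) (h20 : 20 ∉ p.regs) (h3 : 3 ∉ p.arrs)
    (h5 : 5 ∉ p.arrs) : Building X R c j F T s' where
  ctx := h.ctx.frame hk hf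
  reg := (hf.1 20 h20).trans h.reg
  growth := h.growth
  marks := by
    have := h.marks
    unfold Marks at this ⊢
    rwa [hf.2 5 h5]
  row := by
    have := h.row
    exact ⟨by rw [hf.2 3 h3]; exact this.adj, by rw [hf.2 3 h3]; exact this.fresh⟩

theorem Building.setReg {j : Fin g} {T : G.Subgraph} (h : Building X R c j F T s) {r k : ℕ}
    (hr : r ∉ [0, 1, 4, 5, 20] := by decide) : Building X R c j F T (s.setReg r k) where
  ctx := h.ctx.congr (fun r' hr' => by
    have : r' ≠ r := by rintro rfl; simp at hr hr'; omega
    simp [this]) fun _ _ => rfl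
  reg := by
    have : 20 ≠ r := by rintro rfl; simp at hr
    simpa [this] using h.reg
  growth := h.growth
  marks := h.marks
  row := ⟨h.row.adj, h.row.fresh⟩

theorem stepProg_spec {j : Fin g} {T : G.Subgraph} (h : Building X R c j F T s) {u v : Fin n}
    (hu : s.reg 6 = u) (hv : ptr s u = v) (huT : u ∈ T.verts) (hvT : v ∉ T.verts)
    (huv : G.Adj u v)
    (hfar : F.Adj u v ∨ ∀ x ∈ T.verts, ∀ p : F.Walk x v, 2 * R + 2 ≤ p.length) :
    Building X R c j (F ⊔ edge u v) (T ⊔ G.subgraphOfAdj huv) (stepProg.den s) ∧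
      (stepProg.den s).reg 6 = v ∧ OnlyRow j s (stepProg.den s) := by
  have hv' : s.arr 7 0 u = v := hv
  set lam := 2 * R + 2 with hlam
  have h4 : s.reg 4 = lam := h.ctx.reg4
  have hden : stepProg.den s = (((((s.setReg 7 v).setCell 3 j v (u + 1)).setCell 5 j v 1).setCell 4
      u v (lam - 1)).setCell 4 v u (lam - 1)).setReg 6 v := by
    simp [stepProg, Cmd.den, Expr.val, hu, hv', h.reg, h4]
  have hverts : ∀ w, w ∈ (T ⊔ G.subgraphOfAdj huv).verts ↔ w ∈ T.verts ∨ w = v := by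
    intro w
    simp only [Subgraph.verts_sup, subgraphOfAdj_verts, Set.mem_union, Set.mem_insert_iff,
      Set.mem_singleton_iff]
    constructor
    · rintro (h | rfl | rfl) <;> tauto
    · tauto
  rw [hden]
  refine ⟨⟨?_, ?_, h.growth.grow huT hvT huv hfar, ?_, ?_, ?_⟩, ?_, ?_⟩
  · refine ⟨?_, ?_, ?_, ?_, ?_, ?_, ?_⟩
    · simpa using h.ctx.reg0
    · simpa using h.ctx.reg1
    · simpa using h.ctx.reg4
    · simpa using h.ctx.reg5
    · simpa using h.ctx.adj
    · simpa using h.ctx.term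
    · intro a b
      have := h.ctx.bought a b
      have hadj : (F ⊔ edge u v).Adj a b ↔ F.Adj a b ∨ (a = u ∧ b = v ∨ a = v ∧ b = u) := by
        rw [sup_adj, edge_adj]
        constructor
        · tauto
        · rintro (h | ⟨rfl, rfl⟩ | ⟨rfl, rfl⟩)
          · exact .inl h
          · exact .inr ⟨.inl ⟨rfl, rfl⟩, huv.ne⟩
          · exact .inr ⟨.inr ⟨rfl, rfl⟩, huv.ne'⟩
      simp only [Store.setReg_arr, Store.setCell_arr, this, Fin.val_inj, true_and,
        Nat.reduceEqDiff, false_and, if_false]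
      by_cases h1 : a = v ∧ b = u
      · rw [if_pos h1, if_pos (hadj.mpr (.inr (.inr h1)))]
      · rw [if_neg h1]
        by_cases h2 : a = u ∧ b = v
        · rw [if_pos h2, if_pos (hadj.mpr (.inr (.inl h2)))]
        · rw [if_neg h2]
          by_cases h3 : F.Adj a b
          · rw [if_pos h3, if_pos (hadj.mpr (.inl h3))]
          · rw [if_neg h3, if_neg (mt hadj.mp (by tauto))]
  · simpa using h.reg
  · intro w
    have := h.marks w
    simp only [Store.setReg_arr, Store.setCell_arr, this, Fin.val_inj]
    by_cases hwv : w = v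
    · simp [hwv]
    · by_cases hw : w ∈ T.verts
      · rw [if_pos hw, if_pos ((hverts w).mpr (.inl hw))]; simp
      · rw [if_neg hw, if_neg (mt (hverts w).mp (by tauto))]; simp [hwv]
  · intro a b
    have h1 := h.row.adj a b
    have hfr := h.row.fresh v hvT
    have hTv : ∀ w, ¬ T.Adj v w := fun w hw => hvT (T.edge_vert hw)
    have hTv' : ∀ w, ¬ T.Adj w v := fun w hw => hvT (T.edge_vert hw.symm)
    rw [Subgraph.sup_adj, subgraphOfAdj_adj, Sym2.eq_iff, h1]
    simp only [Store.setReg_arr, Store.setCell_arr, Fin.val_inj]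
    have key : ∀ x y : Fin n, s.arr 3 j x = (y : ℕ) + 1 → x ≠ v ∧ y ≠ v := by
      intro x y hxy
      have := (h.row.adj x y).mpr (.inl hxy)
      exact ⟨fun e => hTv y (e ▸ this), fun e => hTv' x (e ▸ this)⟩
    by_cases ha : a = v <;> by_cases hb : b = v
    · subst ha; subst hb
      simp [hfr, huv.ne, huv.ne', Fin.val_inj]
    · subst ha
      have k1 := key b a
      have k2 := key a b
      simp [hb, Fin.val_inj, huv.ne] at k1 k2 ⊢
      tauto
    · subst hb
      have k1 := key b a
      have k2 := key a b
      simp [ha, Fin.val_inj, huv.ne] at k1 k2 ⊢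
      tauto
    · simp [ha, hb]
      tauto
  · intro w hw
    rw [hverts, not_or] at hw
    have := h.row.fresh w hw.1
    simp [this, Fin.val_inj, hw.2]
  · simp
  · intro i hi
    constructor <;> funext w <;> simp [hi]

/-- Within the tree, and along edges bought earlier, the truncated distance `min (d x) (d u)`
changes by at most one; hence all vertices of the tree are far from the next vertex of the path if
the edge to it has not been bought yet. -/
theorem far_of_tight {F₀ : SimpleGraph (Fin n)} {lam : ℕ} {d : Fin n → ℕ} {S : Set (Fin n)}
    (hd : Tight G (len F₀ lam) d) (hF₀ : F₀ ≤ G)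
    (hF : ∀ a b, F.Adj a b → F₀.Adj a b ∨ a ∈ S ∧ b ∈ S) {u v : Fin n}
    (hu : ∀ x ∈ S, d u ≤ d x) (huv : d u = d v + lam) :
    ∀ x ∈ S, ∀ p : F.Walk x v, lam ≤ p.length := by
  have key : ∀ {a b} (p : F.Walk a b), min (d a) (d u) ≤ min (d b) (d u) + p.length := by
    intro a b p
    induction p with
    | nil => simp
    | @cons a a' b haa' p ih =>
      have h1 : min (d a) (d u) ≤ min (d a') (d u) + 1 := by
        rcases hF a a' haa' with h | ⟨h, h'⟩
        · have := hd a a' (hF₀ h)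
          rw [len, if_pos h] at this
          omega
        · have := hu a h
          have := hu a' h'
          omega
      rw [Walk.length_cons]
      omega
  intro x hx p
  have h1 := key p
  have h2 := hu x hx
  omega

/-- The situation before a path is added to the tree: `d` and `q` are the distances and
parent pointers that lead from the tree to the terminals in `Y`. -/
structure Ready (G F₀ : SimpleGraph (Fin n)) (R : ℕ) (Y : Set (Fin n)) (d q : Fin n → ℕ) :
    Prop where
  labels : Labels G (len F₀ (2 * R + 2)) Y (n * (2 * R + 2) + 1) d q
  tight : Tight G (len F₀ (2 * R + 2)) d
  le : F₀ ≤ G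

theorem Ready.next {F₀ : SimpleGraph (Fin n)} {Y : Set (Fin n)} {d q : Fin n → ℕ}
    (h : Ready G F₀ R Y d q) {u : Fin n} (hu : d u ≠ 0) (hu' : d u < n * (2 * R + 2) + 1) :
    ∃ v : Fin n, q u = v ∧ G.Adj u v ∧ d u = d v + len F₀ (2 * R + 2) u v := by
  rcases h.labels.par u with h1 | h1 | ⟨v, h1, h2, h3⟩
  · omega
  · exact absurd (h.labels.source u h1) hu
  · exact ⟨v, h1, h2, le_antisymm (h.tight u v h2) h3⟩

theorem Ready.mem {F₀ : SimpleGraph (Fin n)} {Y : Set (Fin n)} {d q : Fin n → ℕ}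
    (h : Ready G F₀ R Y d q) {u : Fin n} (hu : d u = 0) : u ∈ Y := by
  rcases h.labels.par u with h1 | h1 | ⟨v, h1, h2, h3⟩
  · omega
  · exact h1
  · have := one_le_len (F := F₀) (lam := 2 * R + 2) (by omega) u v
    omega

/-- The path is followed from the nearest vertex of the tree to a terminal. All vertices of the
growing tree are at least as far from the terminals as the current vertex, so that each
step leads to a new vertex. -/
theorem walkProg_spec {j : Fin g} {F₀ : SimpleGraph (Fin n)} {T₀ : G.Subgraph}
    (h : Building X R c j F₀ T₀ s) {Y : Set (Fin n)} {d q : Fin n → ℕ}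
    (hr : Ready G F₀ R Y d q) (hd : dst (n := n) s = d) (hq : ptr (n := n) s = q) {u : Fin n}
    (hu : s.reg 6 = u) (huT : u ∈ T₀.verts) (hmin : ∀ x ∈ T₀.verts, d u ≤ d x)
    (hinf : d u < n * (2 * R + 2) + 1) :
    ∃ (F : SimpleGraph (Fin n)) (T : G.Subgraph), Building X R c j F T (walkProg.den s) ∧
      OnlyRow j s (walkProg.den s) ∧ F₀ ≤ F ∧
      T₀.verts ⊆ T.verts ∧ T.edgeSet.ncard ≤ T₀.edgeSet.ncard + d u ∧ ∃ y ∈ Y, y ∈ T.verts := by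
  have main := Cmd.loop_induction (r := 27) (b := 0)
    (p := .when (.cell 6 (.lit 0) (.reg 6)) stepProg) (s := s)
    (fun k s' => ∃ (F : SimpleGraph (Fin n)) (T : G.Subgraph), Building X R c j F T s' ∧
      OnlyRow j s s' ∧ T₀.verts ⊆ T.verts ∧
      F₀ ≤ F ∧ (∀ a b, F.Adj a b → F₀.Adj a b ∨ a ∈ T.verts ∧ b ∈ T.verts) ∧
      ∃ u' : Fin n, s'.reg 6 = u' ∧ u' ∈ T.verts ∧ (∀ x ∈ T.verts, d u' ≤ d x) ∧
        d u' < n * (2 * R + 2) + 1 ∧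
        T.edgeSet.ncard + d u' ≤ T₀.edgeSet.ncard + d u ∧
        (d u' = 0 ∨ k < T.verts.ncard))
    (by decide) ?_ ?_
  · rw [h.ctx.reg0] at main
    obtain ⟨F, T, h1, h2, h3, h7, -, u', -, h4, -, -, h5, h6⟩ := main
    refine ⟨F, T, h1, h2, h7, h3, by omega, u', ?_, h4⟩
    refine hr.mem (h6.resolve_right fun hlt => ?_)
    have := Set.ncard_le_ncard (Set.subset_univ T.verts)
    rw [Set.ncard_univ, Nat.card_eq_fintype_card, Fintype.card_fin] at this
    omega
  · refine ⟨F₀, T₀, h.setReg, fun _ _ => ⟨rfl, rfl⟩, subset_rfl, le_rfl, fun a b hab => .inl hab, u,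
      by simpa using hu, huT, hmin, hinf, le_rfl, .inr ?_⟩
    exact (Set.ncard_pos (Set.toFinite _)).mpr ⟨u, huT⟩
  rintro k s' hk hrk hf ⟨F, T, h1, h2, h3, h4, h5, u', h6, h7, h8, h9, h10, h11⟩
  have hd' : ∀ x : Fin n, s'.arr 6 0 x = d x := by
    intro x
    rw [hf.2 6 (by decide), ← hd]
    rfl
  have hq' : ptr s' u' = q u' := by
    rw [← hq, ptr, hf.2 7 (by decide)]
    rfl
  simp only [Cmd.den, Expr.val, h6, hd']
  split
  · next h0 =>
    exact ⟨F, T, h1.setReg, h2, h3, h4, h5, u', by simpa using h6, h7, h8, h9, h10, .inl h0⟩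
  · next h0 =>
    obtain ⟨v, hv1, hv2, hv3⟩ := hr.next h0 h9
    have hpos := one_le_len (F := F₀) (lam := 2 * R + 2) (by omega) u' v
    have hvT : v ∉ T.verts := fun hmem => by
      have := h8 v hmem
      omega
    have hfar : F.Adj u' v ∨ ∀ x ∈ T.verts, ∀ p : F.Walk x v, 2 * R + 2 ≤ p.length := by
      by_cases hadj : F₀.Adj u' v
      · exact .inl (h4 hadj)
      · right
        rw [len, if_neg hadj] at hv3
        exact far_of_tight hr.tight hr.le h5 h8 hv3
    obtain ⟨g1, g2, g3⟩ := stepProg_spec h1 h6 (hq'.trans hv1) h7 hvT hv2 hfar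
    have hverts : ∀ w, w ∈ (T ⊔ G.subgraphOfAdj hv2).verts ↔ w ∈ T.verts ∨ w = v := by
      intro w
      simp only [Subgraph.verts_sup, subgraphOfAdj_verts, Set.mem_union, Set.mem_insert_iff,
        Set.mem_singleton_iff]
      constructor
      · rintro (h | rfl | rfl) <;> tauto
      · tauto
    have hncard : (T ⊔ G.subgraphOfAdj hv2).verts.ncard = T.verts.ncard + 1 := by
      rw [show (T ⊔ G.subgraphOfAdj hv2).verts = insert v T.verts by
        ext w; rw [hverts, Set.mem_insert_iff, or_comm], Set.ncard_insert_of_notMem hvT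
        (Set.toFinite _)]
    have e1 := h1.growth.card
    have e2 := g1.growth.card
    refine ⟨_, _, g1.setReg, fun i hi => h2.trans g3 i hi,
      fun x hx => (hverts x).mpr (.inl (h3 hx)),
      h4.trans le_sup_left, ?_, v, by simpa using g2, (hverts v).mpr (.inr rfl), ?_, by omega,
      by omega, by omega⟩
    · intro a b hab
      rw [sup_adj, edge_adj] at hab
      rw [hverts, hverts]
      rcases hab with hab | ⟨⟨rfl, rfl⟩ | ⟨rfl, rfl⟩, -⟩
      · rcases h5 a b hab with h | h
        · exact .inl h
        · exact .inr ⟨.inl h.1, .inl h.2⟩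
      · exact .inr ⟨.inl h7, .inr rfl⟩
      · exact .inr ⟨.inr rfl, .inl h7⟩
    · intro x hx
      rcases (hverts x).mp hx with hx | rfl
      · have := h8 x hx
        omega
      · exact le_rfl

end Trees

end CoverageDesign

/-! ### The trees of all commodities -/

namespace CoverageDesign

open SimpleGraph RAM

section Algorithm

variable {n g : ℕ} {G F : SimpleGraph (Fin n)} {X : Fin g → Finset (Fin n)} {s s' : Store} {R c : ℕ}

theorem OnlyRow.of_frame {p : Cmd} (hf : Cmd.Frame p s s') (h3 : 3 ∉ p.arrs) (h5 : 5 ∉ p.arrs)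
    (j : ℕ) : OnlyRow j s s' := fun i _ => by
  rw [hf.2 3 h3, hf.2 5 h5]
  exact ⟨rfl, rfl⟩

theorem dist_lt_card {V : Type*} [Fintype V] {G : SimpleGraph V} {x y : V} (h : G.Reachable x y) :
    G.dist x y < Fintype.card V := by
  obtain ⟨p, hp, hlen⟩ := h.exists_path_of_dist
  rw [← hlen]
  exact hp.length_lt

/-- The new path is paid by the link that becomes redundant. -/
theorem roundProg_spec {j : Fin g} {T : G.Subgraph} (h : Building X R c j F T s) (hR : R + 1 ≤ g)
    {b : ℕ} (hb : Budget G (X j) T.verts b) :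
    ∃ (F' : SimpleGraph (Fin n)) (T' : G.Subgraph), Building X R c j F' T' (roundProg.den s) ∧
      OnlyRow j s (roundProg.den s) ∧ F ≤ F' ∧ T.verts ⊆ T'.verts ∧
      (∃ b', Budget G (X j) T'.verts b' ∧
        T'.edgeSet.ncard + (2 * R + 2) * b' ≤ T.edgeSet.ncard + (2 * R + 2) * b) ∧
      ((X j : Set (Fin n)) ⊆ T.verts ∨ T.verts.ncard < T'.verts.ncard) := by
  set Y : Set (Fin n) := (X j : Set (Fin n)) \ T.verts with hY
  set s₁ := initProg.den s with hs₁
  set s₂ := distProg.den s₁ with hs₂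
  set s₃ := selectProg.den s₂ with hs₃
  have hf₁ : Cmd.Frame initProg s s₁ := Cmd.frame_den _ _
  have hf₂ : Cmd.Frame distProg s₁ s₂ := Cmd.frame_den _ _
  have hf₃ : Cmd.Frame selectProg s₂ s₃ := Cmd.frame_den _ _
  have h₁ : Building X R c j F T s₁ :=
    h.frame hf₁ (by decide) (by decide) (by decide) (by decide)
  have h₂ : Building X R c j F T s₂ :=
    h₁.frame hf₂ (by decide) (by decide) (by decide) (by decide)
  have h₃ : Building X R c j F T s₃ :=
    h₂.frame hf₃ (by decide) (by decide) (by decide) (by decide)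
  have hrow : OnlyRow j s s₃ := (OnlyRow.of_frame hf₁ (by decide) (by decide) j).trans <|
    (OnlyRow.of_frame hf₂ (by decide) (by decide) j).trans <|
    OnlyRow.of_frame hf₃ (by decide) (by decide) j
  have hL := initProg_spec h.ctx h.reg h.marks
  obtain ⟨hL₂, ht₂⟩ := distProg_spec h₁.ctx (by omega) (by omega) (by omega) hL
  rw [← hs₂] at hL₂ ht₂
  have hr : Ready G F R Y (dst s₂) (ptr s₂) := ⟨hL₂, ht₂, h.growth.le⟩
  obtain ⟨m, hm, -, hm2, hm3⟩ := selectProg_spec h₂.ctx h₂.reg h₂.marks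
  have hden : roundProg.den s = if n * (2 * R + 2) + 1 - m = 0 then s₃ else walkProg.den s₃ := by
    rw [← h₃.ctx.reg5, ← hm]
    rfl
  -- any terminal outside the tree gives an upper bound for the minimum distance
  have hbound : ∀ a ∈ T.verts, ∀ x ∈ (X j : Set (Fin n)), x ∉ T.verts → G.Reachable a x →
      m ≤ (2 * R + 2) * G.dist a x := by
    intro a ha x hx hxT hax
    have h1 := ht₂.le_add_mul_dist (len_le (by omega)) hax
    rw [hL₂.source x ⟨hx, hxT⟩, zero_add] at h1
    exact (hm2 a ha).trans h1
  by_cases hsub : (X j : Set (Fin n)) ⊆ T.verts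
  · have hYe : Y = ∅ := Set.sdiff_eq_empty.mpr hsub
    -- without terminals, all distances remain infinite
    have hm4 : n * (2 * R + 2) + 1 - m = 0 := by
      by_contra hlt
      obtain ⟨u, hu, -, hu2⟩ := hm3 (by omega)
      have hchain : ∀ k, ∀ x : Fin n, dst s₂ x = k → n * (2 * R + 2) + 1 ≤ k := by
        intro k
        induction k using Nat.strong_induction_on with
        | _ k ih =>
        intro x hx
        rcases hL₂.par x with h1 | h1 | ⟨v, -, -, h3⟩
        · omega
        · rw [← hY, hYe] at h1
          exact absurd h1 (Set.notMem_empty x)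
        · have := one_le_len (F := F) (lam := 2 * R + 2) (by omega) x v
          have := ih (dst s₂ v) (by omega) v rfl
          omega
      have := hchain m u hu2
      omega
    rw [hden, if_pos hm4]
    exact ⟨F, T, h₃, hrow, le_rfl, subset_rfl, ⟨b, hb, le_rfl⟩, .inl hsub⟩
  · obtain ⟨y, hyX, hyT⟩ := Set.not_subset.mp hsub
    have hfin : m < n * (2 * R + 2) + 1 := by
      obtain ⟨a, ha, x, hx, hxT, hax, -⟩ :=
        hb.step hyX hyT (Set.subset_insert y T.verts) (Set.mem_insert y _)
      have h1 := hbound a ha x hx hxT hax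
      have h2 := dist_lt_card hax
      rw [Fintype.card_fin] at h2
      have h3 := Nat.mul_le_mul_left (2 * R + 2) h2.le
      rw [mul_comm _ n] at h3
      omega
    obtain ⟨u, huT, hu1, hu2⟩ := hm3 hfin
    rw [hden, if_neg (by omega)]
    have hd₃ : dst (n := n) s₃ = dst s₂ := by
      funext v
      rw [dst, hf₃.2 6 (by decide)]
      rfl
    have hq₃ : ptr (n := n) s₃ = ptr s₂ := by
      funext v
      rw [ptr, hf₃.2 7 (by decide)]
      rfl
    obtain ⟨F', T', g1, g2, g3, g4, g5, z, hz, hzT⟩ := walkProg_spec h₃ hr hd₃ hq₃ hu1 huT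
      (fun x hx => hu2 ▸ hm2 x hx) (hu2 ▸ hfin)
    obtain ⟨a, ha, x, hx, hxT, hax, b', hb', hb''⟩ := hb.step hz.1 hz.2 g4 hzT
    refine ⟨F', T', g1, hrow.trans g2, g3, g4, ⟨b', hb'', ?_⟩, .inr ?_⟩
    · have h1 := hbound a ha x hx hxT hax
      have h2 := Nat.mul_le_mul_left (2 * R + 2) hb'
      rw [mul_add] at h2
      omega
    · exact Set.ncard_lt_ncard ⟨g4, fun hle => hz.2 (hle hzT)⟩ (Set.toFinite _)

/-- Each round either adds a vertex to the tree or finds all terminals connected, so `n` rounds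
suffice. -/
theorem treeProg_spec (hc : Ctx G F X (2 * R + 2) s) {j : Fin g} (hj : s.reg 20 = j) (hn : 0 < n)
    (hF : F ≤ G) {k : ℕ} (hk : Charged R g F k) (hkc : g * k ≤ c) (hR : R + 1 ≤ g)
    (h3 : ∀ v : Fin n, s.arr 3 j v = 0) (h5 : ∀ v : Fin n, s.arr 5 j v = 0) {b : ℕ}
    (hb : ∀ x, ((X j).Nonempty → x ∈ X j) → Budget G (X j) {x} b) :
    ∃ (F' : SimpleGraph (Fin n)) (T : G.Subgraph), Building X R c j F' T (treeProg.den s) ∧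
      OnlyRow j s (treeProg.den s) ∧ F ≤ F' ∧ (X j : Set (Fin n)) ⊆ T.verts ∧
      T.edgeSet.ncard ≤ (2 * R + 2) * b := by
  obtain ⟨x, hx1, hx2, hx3⟩ := rootProg_spec hc hj hn (fun v => by rw [h5]; simp)
  set s₁ := rootProg.den s with hs₁
  have hf₁ : Cmd.Frame rootProg s s₁ := Cmd.frame_den _ _
  have hB : Building X R c j F (G.singletonSubgraph x) s₁ := by
    refine ⟨hc.frame (by decide) hf₁, (hf₁.1 20 (by decide)).trans hj, .start hF hk hkc x, ?_, ?_⟩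
    · rwa [singletonSubgraph_verts]
    · refine ⟨fun v w => ?_, fun v _ => ?_⟩
      · rw [hf₁.2 3 (by decide), h3, h3]
        simp
      · rw [hf₁.2 3 (by decide), h3]
  have hrow : OnlyRow j s s₁ := fun i hi => ⟨by rw [hf₁.2 3 (by decide)], hx3 i hi⟩
  have main := Cmd.loop_induction (r := 21) (b := 0) (p := roundProg) (s := s₁)
    (fun k s' => ∃ (F' : SimpleGraph (Fin n)) (T : G.Subgraph), Building X R c j F' T s' ∧
      OnlyRow j s s' ∧ F ≤ F' ∧
      (∃ b', Budget G (X j) T.verts b' ∧ T.edgeSet.ncard + (2 * R + 2) * b' ≤ (2 * R + 2) * b) ∧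
      ((X j : Set (Fin n)) ⊆ T.verts ∨ k < T.verts.ncard)) (by decide) ?_ ?_
  · rw [hB.ctx.reg0] at main
    obtain ⟨F', T, h1, h2, h3, ⟨b', -, h4⟩, h5⟩ := main
    refine ⟨F', T, h1, h2, h3, h5.resolve_right fun hlt => ?_, by omega⟩
    have := Set.ncard_le_ncard (Set.subset_univ T.verts)
    rw [Set.ncard_univ, Nat.card_eq_fintype_card, Fintype.card_fin] at this
    omega
  · refine ⟨F, _, hB.setReg, hrow, le_rfl, ⟨b, ?_, by simp⟩, .inr (by simp)⟩
    rw [singletonSubgraph_verts]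
    exact hb x hx1
  · rintro k s' - - - ⟨F', T, h1, h2, h3, ⟨b', h4, h5⟩, h6⟩
    obtain ⟨F'', T', g1, g2, g3, g4, ⟨b'', g5, g6⟩, g7⟩ := roundProg_spec h1 hR h4
    refine ⟨F'', T', g1.setReg, fun i hi => h2.trans g2 i hi, h3.trans g3,
      ⟨b'', g5, by omega⟩, ?_⟩
    rcases h6 with h6 | h6
    · exact .inl (h6.trans g4)
    · rcases g7 with g7 | g7
      · exact .inl (g7.trans g4)
      · exact .inr (by omega)

/-- What the algorithm achieves: each tree is at most `2 * R + 2` times as expensive as the budget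
allows, and all trees together use at most `3 * n` edges. -/
theorem mainProg_spec {m : ℕ} (D : Fin g → Finset (Fin m)) (hn : 0 < n) {B : Fin g → ℕ}
    (hB : ∀ j x, ((X j).Nonempty → x ∈ X j) → Budget G (X j) {x} (B j)) :
    ∃ (R : ℕ) (F : SimpleGraph (Fin n)) (T : Fin g → G.Subgraph),
      (R = 0 ∨ 2 ^ (R - 1) < g) ∧ (0 < g → F.edgeSet.ncard ≤ 3 * n) ∧
      IsOutput (mainProg.den (input G X D)) T ∧ IsSolution X T ∧
      ∀ j, (∀ a b, (T j).Adj a b → F.Adj a b) ∧ (T j).edgeSet.ncard ≤ (2 * R + 2) * B j := by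
  set s₁ := lengthProg.den (input G X D) with hs₁
  set s₂ := infProg.den s₁ with hs₂
  have hf₁ : Cmd.Frame lengthProg (input G X D) s₁ := Cmd.frame_den _ _
  have hf₂ : Cmd.Frame infProg s₁ s₂ := Cmd.frame_den _ _
  obtain ⟨R, hR1, hR2, hR3⟩ := lengthProg_spec (input G X D)
  change g ≤ 2 ^ R at hR2
  change _ ∨ 2 ^ (R - 1) < g at hR3
  have hRg : 0 < g → R + 1 ≤ g := by
    intro hg
    rcases hR3 with h | h
    · omega
    · have := (R - 1).lt_two_pow_self
      omega
  have harr : s₂.arr = (input G X D).arr := by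
    funext a
    rw [hf₂.2 a (by simp [infProg, Cmd.arrs]), hf₁.2 a (by simp [lengthProg, Cmd.arrs])]
  have hreg0 : s₁.reg 0 = n := hf₁.1 0 (by decide)
  have hc : Ctx G ⊥ X (2 * R + 2) s₂ := by
    refine ⟨(hf₂.1 0 (by decide)).trans hreg0, (hf₂.1 1 (by decide)).trans (hf₁.1 1 (by decide)),
      (hf₂.1 4 (by decide)).trans hR1, ?_, ?_, ?_, ?_⟩
    · rw [hs₂, infProg_spec, hreg0, hR1]
    · intro u v
      rw [harr]
      simp only [input]
      constructor
      · intro h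
        by_contra hadj
        refine h (if_neg ?_)
        rintro ⟨u', v', h1, h2, h3⟩
        rw [Fin.val_inj] at h1 h2
        subst h1; subst h2
        exact hadj h3
      · intro h
        rw [if_pos ⟨u, v, rfl, rfl, h⟩]
        exact one_ne_zero
    · intro j v
      rw [harr]
      simp only [input]
      by_cases h : v ∈ X j
      · rw [if_pos h, if_pos ⟨j, v, rfl, rfl, h⟩]
      · rw [if_neg h, if_neg]
        rintro ⟨j', v', h1, h2, h3⟩
        rw [Fin.val_inj] at h1 h2
        subst h1; subst h2
        exact h h3
    · intro u v
      rw [harr]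
      simp [input]
  have main := Cmd.loop_induction (r := 20) (b := 1) (p := treeProg) (s := s₂)
    (fun k s' => ∃ F : SimpleGraph (Fin n), Ctx G F X (2 * R + 2) s' ∧ F ≤ G ∧
      (∃ l, Charged R g F l ∧ g * l ≤ k * n) ∧
      (∀ j : Fin g, (j : ℕ) < k → ∃ T : G.Subgraph, T.coe.IsTree ∧ (X j : Set (Fin n)) ⊆ T.verts ∧
        (∀ a b, T.Adj a b → F.Adj a b) ∧ T.edgeSet.ncard ≤ (2 * R + 2) * B j ∧
        ∀ v w, T.Adj v w ↔ s'.arr 3 j v = (w : ℕ) + 1 ∨ s'.arr 3 j w = (v : ℕ) + 1) ∧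
      ∀ j : Fin g, k ≤ j → ∀ v : Fin n, s'.arr 3 j v = 0 ∧ s'.arr 5 j v = 0) (by decide) ?_ ?_
  · rw [hc.reg1] at main
    obtain ⟨F, -, -, ⟨l, hl1, hl2⟩, hT, -⟩ := main
    choose T h1 h2 h3 h4 h5 using fun j : Fin g => hT j j.isLt
    refine ⟨R, F, T, hR3, fun hg => ?_, h5, fun j => ⟨h1 j, fun v hv => h2 j hv⟩,
      fun j => ⟨h3 j, h4 j⟩⟩
    have := hl1.card_edgeSet_le hR2
    rw [Fintype.card_fin] at this
    have := Nat.le_of_mul_le_mul_left hl2 hg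
    omega
  · refine ⟨⊥, hc.congr (by simp) (by simp), bot_le, ⟨0, ⟨⊥, .bot, le_rfl, by simp⟩, by simp⟩,
      by simp, fun j _ v => ?_⟩
    rw [Store.setReg_arr, harr]
    exact ⟨rfl, rfl⟩
  · rintro k s' hk hrk hf ⟨F, h1, h2, ⟨l, h3, h4⟩, h5, h6⟩
    rw [hc.reg1] at hk
    have h7 := h6 ⟨k, hk⟩ le_rfl
    obtain ⟨F', T, g1, g2, g3, g4, g5⟩ := treeProg_spec h1 (j := ⟨k, hk⟩) hrk hn h2 h3 h4
      (hRg (by omega)) (fun v => (h7 v).1) (fun v => (h7 v).2) (hB ⟨k, hk⟩)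
    refine ⟨F', g1.ctx.congr (by simp) (by simp), g1.growth.le, ?_, ?_, ?_⟩
    · obtain ⟨l', hl1, hl2⟩ := g1.growth.charged
      rw [Fintype.card_fin] at hl2
      exact ⟨l', hl1, by rw [add_mul, one_mul]; exact hl2⟩
    · intro i hi
      rcases Nat.lt_succ_iff_lt_or_eq.mp hi with hi | hi
      · obtain ⟨T', e1, e2, e3, e4, e5⟩ := h5 i hi
        refine ⟨T', e1, e2, fun a b hab => g3 (e3 a b hab), e4, ?_⟩
        rw [Store.setReg_arr, (g2 i hi.ne).1]
        exact e5
      · obtain rfl : i = ⟨k, hk⟩ := Fin.ext hi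
        exact ⟨T, g1.growth.isTree, g4, g1.growth.sub, g5, g1.row.adj⟩
    · intro i hi v
      have hne : (i : ℕ) ≠ k := by omega
      rw [Store.setReg_arr, (g2 i hne).1, (g2 i hne).2]
      exact h6 i (by omega) v

end Algorithm

end CoverageDesign

/-! ### Comparison of costs -/

namespace CoverageDesign

open SimpleGraph RAM

section Cost

variable {n g m : ℕ} {G : SimpleGraph (Fin n)}

/-- If there is just one demand set, the common part may be chosen to be empty. -/
theorem IsSunflower.exists_kernel {D : Fin g → Finset (Fin m)} (h : IsSunflower D) :
    ∃ P : Finset (Fin m), (∀ j, P ⊆ D j) ∧ ∀ i j, i ≠ j → D i ∩ D j = P := by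
  obtain ⟨P, hP⟩ := h
  by_cases hg : ∃ i j : Fin g, i ≠ j
  · refine ⟨P, fun k => ?_, hP⟩
    obtain ⟨i, j, hij⟩ := hg
    have : ∃ l, k ≠ l := by
      by_cases hk : k = i
      · exact ⟨j, hk ▸ hij⟩
      · exact ⟨i, hk⟩
    obtain ⟨l, hl⟩ := this
    rw [← hP k l hl]
    exact Finset.inter_subset_left
  · push Not at hg
    exact ⟨∅, by simp, fun i j hij => absurd (hg i j) hij⟩

/-- The edges that are used by some tree. -/
def usedEdges (T : Fin g → G.Subgraph) : Set (Sym2 (Fin n)) := {e | ∃ j, e ∈ (T j).edgeSet}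

open Classical in
/-- On an edge that is used at all, the packets are those of the kernel and of the disjoint
petals. -/
theorem load_eq {D : Fin g → Finset (Fin m)} {P : Finset (Fin m)} (hP : ∀ j, P ⊆ D j)
    (hD : ∀ i j, i ≠ j → D i ∩ D j = P) (T : Fin g → G.Subgraph) (e : Sym2 (Fin n)) :
    load D T e = (if e ∈ usedEdges T then P.card else 0) +
      ∑ j, if e ∈ (T j).edgeSet then (D j \ P).card else 0 := by
  rw [load, ← Finset.sum_filter]
  set J := Finset.univ.filter fun j : Fin g => e ∈ (T j).edgeSet with hJ
  by_cases h : e ∈ usedEdges T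
  · obtain ⟨j₀, hj₀⟩ := id h
    have hj₀J : j₀ ∈ J := by simp [hJ, hj₀]
    rw [if_pos h]
    have h1 : J.biUnion D = P ∪ J.biUnion fun j => D j \ P := by
      ext x
      simp only [Finset.mem_union, Finset.mem_biUnion, Finset.mem_sdiff]
      constructor
      · rintro ⟨j, hj, hx⟩
        by_cases hxP : x ∈ P
        · exact .inl hxP
        · exact .inr ⟨j, hj, hx, hxP⟩
      · rintro (hx | ⟨j, hj, hx, -⟩)
        · exact ⟨j₀, hj₀J, hP j₀ hx⟩
        · exact ⟨j, hj, hx⟩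
    rw [h1, Finset.card_union_of_disjoint, Finset.card_biUnion]
    · intro i _ j _ hij
      rw [Function.onFun, Finset.disjoint_left]
      intro x hxi hxj
      rw [Finset.mem_sdiff] at hxi hxj
      exact hxi.2 (hD i j hij ▸ Finset.mem_inter.mpr ⟨hxi.1, hxj.1⟩)
    · rw [Finset.disjoint_left]
      intro x hx hx'
      rw [Finset.mem_biUnion] at hx'
      obtain ⟨j, -, hj⟩ := hx'
      exact (Finset.mem_sdiff.mp hj).2 hx
  · have hJe : J = ∅ := by
      rw [hJ, Finset.filter_eq_empty_iff]
      exact fun j _ hj => h ⟨j, hj⟩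
    rw [if_neg h, hJe]
    simp

open Classical in
theorem routingCost_eq {D : Fin g → Finset (Fin m)} {P : Finset (Fin m)} (hP : ∀ j, P ⊆ D j)
    (hD : ∀ i j, i ≠ j → D i ∩ D j = P) (T : Fin g → G.Subgraph) :
    routingCost D T = P.card * (usedEdges T).ncard +
      ∑ j, (D j \ P).card * (T j).edgeSet.ncard := by
  have key : ∀ A : Set (Sym2 (Fin n)), A ⊆ G.edgeSet → ∀ k : ℕ,
      (∑ e ∈ G.edgeFinset, if e ∈ A then k else 0) = k * A.ncard := by
    intro A hA k
    rw [← Finset.sum_filter, Finset.sum_const, smul_eq_mul, mul_comm, ← Set.ncard_coe_finset]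
    congr 2
    ext e
    simp only [Finset.coe_filter, mem_edgeFinset, Set.mem_ofPred_eq]
    exact ⟨fun h => h.2, fun h => ⟨hA h, h⟩⟩
  rw [routingCost, Finset.sum_congr rfl fun e _ => load_eq hP hD T e, Finset.sum_add_distrib,
    Finset.sum_comm]
  congr 1
  · refine key (usedEdges T) ?_ P.card
    rintro e ⟨j, hj⟩
    exact (T j).edgeSet_subset hj
  · exact Finset.sum_congr rfl fun j _ => key _ (T j).edgeSet_subset _

/-- If every vertex is to be connected with some other vertex, then a solution
uses at least half as many edges as there are vertices. -/
theorem le_two_mul_ncard_usedEdges {X : Fin g → Finset (Fin n)}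
    (hX : ∀ v : Fin n, ∃ j : Fin g, v ∈ X j ∧ 2 ≤ (X j).card) {T : Fin g → G.Subgraph}
    (hT : IsSolution X T) : n ≤ 2 * (usedEdges T).ncard := by
  classical
  have hinc : ∀ v : Fin n, ∃ e ∈ usedEdges T, v ∈ e := by
    intro v
    obtain ⟨j, hv, hj⟩ := hX v
    obtain ⟨w, hw, hwv⟩ := Finset.exists_mem_ne (show 1 < (X j).card by omega) v
    obtain ⟨p⟩ := (hT j).1.connected.preconnected ⟨v, (hT j).2 v hv⟩ ⟨w, (hT j).2 w hw⟩
    cases p with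
    | nil => exact absurd rfl hwv
    | @cons _ y _ h p => exact ⟨s(v, (y : Fin n)), ⟨j, h⟩, by simp⟩
  have hsub : (Finset.univ : Finset (Fin n)) ⊆
      (usedEdges T).toFinite.toFinset.biUnion fun e => e.toFinset := by
    intro v _
    obtain ⟨e, he, hv⟩ := hinc v
    rw [Finset.mem_biUnion]
    exact ⟨e, by simpa using he, by simpa using hv⟩
  have h1 := Finset.card_le_card hsub
  have h2 := Finset.card_biUnion_le_card_mul (usedEdges T).toFinite.toFinset
    (fun e => e.toFinset) 2 (fun e _ => by rw [Sym2.card_toFinset]; split <;> omega)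
  rw [Finset.card_univ, Fintype.card_fin] at h1
  rw [Set.ncard_eq_toFinset_card _ (usedEdges T).toFinite]
  omega

/-- A bound on each tree, and a bound on all trees together, give the approximation ratio. -/
theorem routingCost_le {X : Fin g → Finset (Fin n)} {D : Fin g → Finset (Fin m)}
    (hD : IsSunflower D) (hX : ∀ v : Fin n, ∃ j : Fin g, v ∈ X j ∧ 2 ≤ (X j).card)
    {T T' : Fin g → G.Subgraph} (hT' : IsSolution X T') {K : ℕ} (hK : 6 ≤ K)
    (hU : (usedEdges T).ncard ≤ 3 * n)
    (hE : ∀ j, (T j).edgeSet.ncard ≤ K * (T' j).edgeSet.ncard) :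
    routingCost D T ≤ K * routingCost D T' := by
  obtain ⟨P, hP, hP'⟩ := hD.exists_kernel
  rw [routingCost_eq hP hP', routingCost_eq hP hP', mul_add, Finset.mul_sum]
  refine add_le_add ?_ (Finset.sum_le_sum fun j _ => ?_)
  · have h1 := le_two_mul_ncard_usedEdges hX hT'
    calc P.card * (usedEdges T).ncard ≤ P.card * (6 * (usedEdges T').ncard) :=
          Nat.mul_le_mul_left _ (by omega)
      _ ≤ P.card * (K * (usedEdges T').ncard) :=
          Nat.mul_le_mul_left _ (Nat.mul_le_mul_right _ hK)
      _ = _ := by ring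
  · calc _ ≤ (D j \ P).card * (K * (T' j).edgeSet.ncard) := Nat.mul_le_mul_left _ (hE j)
      _ = _ := by ring

/-- The length `2 * R + 2` of the edges that have not been bought is logarithmic in `g`. -/
theorem two_mul_add_two_le {R : ℕ} (hR : R = 0 ∨ 2 ^ (R - 1) < g) :
    ((2 * R + 2 : ℕ) : ℝ) ≤ 6 * max 1 (Real.logb 2 g) := by
  have h1 := le_max_left 1 (Real.logb 2 g)
  have h2 := le_max_right 1 (Real.logb 2 g)
  push_cast
  rcases hR with rfl | hR
  · norm_num; linarith
  · rcases Nat.eq_zero_or_pos R with rfl | hpos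
    · norm_num; linarith
    have hR' : (R : ℝ) - 1 ≤ Real.logb 2 g := by
      have h3 : ((2 : ℝ) ^ (R - 1)) ≤ g := by exact_mod_cast hR.le
      have h4 : (0 : ℝ) < g := lt_of_lt_of_le (by positivity) h3
      rw [Real.le_logb_iff_rpow_le (by norm_num) h4]
      rw [show (R : ℝ) - 1 = ((R - 1 : ℕ) : ℝ) by push_cast [Nat.cast_sub hpos]; ring,
        Real.rpow_natCast]
      exact h3
    linarith

end Cost

end CoverageDesign

open CoverageDesign RAM in
theorem mainTheorem2 :
    ∃ (alg : RAM.Prog) (C : ℝ) (p : Polynomial ℕ),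
      ∀ (n g m : ℕ) (G : SimpleGraph (Fin n)) (X : Fin g → Finset (Fin n))
        (D : Fin g → Finset (Fin m)),
        CoverageDesign.IsSunflower D →
        (∀ v : Fin n, ∃ j : Fin g, v ∈ X j ∧ 2 ≤ (X j).card) →
        (∃ T : Fin g → G.Subgraph, CoverageDesign.IsSolution X T) →
        ∃ (t : ℕ) (s : RAM.Store) (T : Fin g → G.Subgraph),
          RAM.Exec alg (CoverageDesign.input G X D) t s ∧
          t ≤ p.eval (n + g) ∧
          CoverageDesign.IsOutput s T ∧
          CoverageDesign.IsSolution X T ∧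
          ∀ T' : Fin g → G.Subgraph, CoverageDesign.IsSolution X T' →
            (CoverageDesign.routingCost D T : ℝ) ≤
              C * max 1 (Real.logb 2 g) * (CoverageDesign.routingCost D T' : ℝ) := by
  refine ⟨mainProg.toProg, 12, mainProg.time, ?_⟩
  intro n g m G X D hD hX hfeas
  obtain ⟨t, ht, hexec⟩ := Cmd.exists_exec mainProg_ok (N := n + g) (input G X D)
    (Nat.le_add_right n g) (Nat.le_add_left g n)
  refine ⟨t, mainProg.den (input G X D), ?_⟩
  obtain ⟨T₀, hT₀⟩ := hfeas
  rcases Nat.eq_zero_or_pos g with rfl | hg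
  · -- without commodities, nothing is routed
    refine ⟨T₀, hexec, ht, fun j => j.elim0, hT₀, fun T' _ => ?_⟩
    have : routingCost D T₀ = 0 := by simp [routingCost, load]
    rw [this, Nat.cast_zero]
    have := le_max_left 1 (Real.logb 2 ((0 : ℕ) : ℝ))
    positivity
  have hn : 0 < n := by
    obtain ⟨v⟩ := (hT₀ ⟨0, hg⟩).1.connected.nonempty
    exact (Nat.zero_le _).trans_lt v.1.isLt
  -- for each commodity, the least number of edges of a tree in a solution
  set M : Fin g → Set ℕ := fun j =>
    {k | ∃ T : Fin g → G.Subgraph, IsSolution X T ∧ (T j).edgeSet.ncard = k} with hM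
  have hB : ∀ j x, ((X j).Nonempty → x ∈ X j) → Budget G (X j) {x} (2 * sInf (M j)) := by
    intro j x hx
    obtain ⟨T, hT, hmin⟩ := Nat.sInf_mem (s := M j) ⟨_, T₀, hT₀, rfl⟩
    rw [← hmin]
    rcases (X j).eq_empty_or_nonempty with h | h
    · exact ⟨∅, by simp, by simp [h], by simp⟩
    · exact budget_of_isTree (hT j).1 (fun v hv => (hT j).2 v hv) (hx h)
  obtain ⟨R, F, T, hR, hF, hout, hsol, hT⟩ := mainProg_spec D hn hB
  refine ⟨T, hexec, ht, hout, hsol, fun T' hT' => ?_⟩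
  have hU : (usedEdges T).ncard ≤ 3 * n := by
    refine (Set.ncard_le_ncard ?_ (Set.toFinite _)).trans (hF hg)
    rintro e ⟨j, hj⟩
    induction e using Sym2.ind with
    | _ a b => exact (hT j).1 a b hj
  have hE : ∀ j, (T j).edgeSet.ncard ≤ max 6 (2 * (2 * R + 2)) * (T' j).edgeSet.ncard := by
    intro j
    have h1 : sInf (M j) ≤ (T' j).edgeSet.ncard := Nat.sInf_le ⟨T', hT', rfl⟩
    calc (T j).edgeSet.ncard ≤ (2 * R + 2) * (2 * sInf (M j)) := (hT j).2
      _ = 2 * (2 * R + 2) * sInf (M j) := by ring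
      _ ≤ _ := Nat.mul_le_mul (le_max_right _ _) h1
  have hcost := routingCost_le hD hX hT' (le_max_left 6 _) hU hE
  have hK : ((max 6 (2 * (2 * R + 2)) : ℕ) : ℝ) ≤ 12 * max 1 (Real.logb 2 g) := by
    have h1 := two_mul_add_two_le hR
    have h2 := le_max_left 1 (Real.logb 2 g)
    rw [Nat.cast_max, max_le_iff]
    refine ⟨by norm_num; linarith, ?_⟩
    rw [Nat.cast_mul]
    norm_num at h1 ⊢
    linarith
  calc (routingCost D T : ℝ)
      ≤ ((max 6 (2 * (2 * R + 2)) : ℕ) : ℝ) * (routingCost D T' : ℝ) := by exact_mod_cast hcost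
    _ ≤ _ := mul_le_mul_of_nonneg_right hK (Nat.cast_nonneg _)
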